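/- For $a\in\mathbb R$ let $\mathcal R_a=(\mathbb R,<,+,\mathbb Z,\mathbb Z a)$, and let $\mathcal B=(\mathbb N,\mathcal P(\mathbb N),s_{\mathbb N},\in)$ be the two-sorted B\"uchi structure, where $\mathbb N=\{0,1,2,\dots\}$, $s_{\mathbb N}$ is the successor function and $\in$ is the membership relation between $\mathbb N$ and $\mathcal P(\mathbb N)$. Definable means definable without parameters. **(1)** For every irrational $a\in\mathbb R$, the structure $\mathcal R_a$ defines an isomorphic copy of $\mathcal B$: there are definable sets $S\subseteq\mathbb R^m$ and $T\subseteq\mathbb R^n$, a function $S\to S$ with definable graph, and a definable relation between $S$ and $T$, such that the resulting two-sorted structure is isomorphic to $\mathcal B$. **(2)** Let moreover $\tfrac32<a<2$. Let $[a_0;a_1,a_2,\dots]$ be the continued fraction expansion of $a$, $p_k/q_k$ (in lowest terms, $q_k>0$) its $k$-th convergent, $\beta_k=q_ka-p_k$ and $I=[1-a,2-a)$. Let $U$ be the set of pairs $(p,qa)$ with $p,q\in\mathbb N$, $q\ge1$, such that $|q'a-p'|>|qa-p|$ for all $(p',q')\in\mathbb N^2$ with $1\le q'\le q$ and $(p',q')\ne(p,q)$.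 Then: * $U$ is definable in $\mathcal R_a$, and its projection to the second coordinate is $\{q_ka : k\ge1\}$; in particular the latter set is definable in $\mathcal R_a$. * Every $c\in I$ has a unique Ostrowski representation $c=\sum_{k=0}^\infty b_{k+1}\beta_k$, that is, one with $b_k\in\mathbb N$, $b_1<a_1$, $b_k\le a_k$ for $k>1$, $b_k=0$ whenever $b_{k+1}=a_{k+1}$, and $b_k<a_k$ for infinitely many odd $k$. Write $b_k(c)$ for its digits. For $i\in\{0,1\}$ the set $E_i=\{(q_la,c) : l\ge1,\ c\in I,\ b_{l+1}(c)=i\}$ is definable in $\mathcal R_a$. * Let $W=\{q_la : l\text{ odd}\}$, let $s_W$ be the successor function of the ordered set $(W,<)$, and let $J'$ be the set of all $c\in I$ with $b_{l+1}(c)\in\{0,1\}$ for all $l\ge1$ and $b_{l+1}(c)=0$ for all even $l\ge1$. Then $W$, $J'$ and the graph of $s_W$ are definable in $\mathcal R_a$; the map $h_1:W\to\mathbb N$, $q_la\mapsto\frac{l-1}2$, is well defined; and, with $h_2:J'\to\mathcal P(\mathbb N)$, $h_2(c)=\{\frac{l-1}2 : l\text{ odd},\ (q_la,c)\in E_1\}$,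 the pair $(h_1,h_2)$ is an isomorphism from $(W,J',s_W,E_1)$ (with $E_1$ restricted to $W\times J'$) to $\mathcal B$. -/

import Mathlib

/-! ### The structure `(ℝ, <, +, ℤ, ℤa)` -/

/-- Function symbols: one binary symbol `+`. -/
inductive LatticeFunc : ℕ → Type
  | add : LatticeFunc 2

/-- Relation symbols: a binary `<` and two unary predicates, for `ℤ` and for `ℤa`. -/
inductive LatticeRel : ℕ → Type
  | lt : LatticeRel 2
  | isInt : LatticeRel 1
  | isIntMul : LatticeRel 1

/-- The first-order language of the structures `(ℝ, <, +, ℤ, ℤa)`. -/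
def latticeLang : FirstOrder.Language.{0, 0} := ⟨LatticeFunc, LatticeRel⟩

/-- The structure `R_a = (ℝ, <, +, ℤ, ℤa)`. -/
@[reducible] noncomputable def structR (a : ℝ) : latticeLang.Structure ℝ where
  funMap := fun f => match f with
    | LatticeFunc.add => fun v => v 0 + v 1
  RelMap := fun r => match r with
    | LatticeRel.lt => fun v => v 0 < v 1
    | LatticeRel.isInt => fun v => ∃ n : ℤ, v 0 = n
    | LatticeRel.isIntMul => fun v => ∃ n : ℤ, v 0 = n * a

/-- `S ⊆ ℝ` is definable without parameters in `R_a`. -/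
def DefinableInR₁ (a : ℝ) (S : Set ℝ) : Prop :=
  @Set.Definable₁ ℝ ∅ latticeLang (structR a) S

/-- `S ⊆ ℝ²` is definable without parameters in `R_a`. -/
def DefinableInR₂ (a : ℝ) (S : Set (ℝ × ℝ)) : Prop :=
  @Set.Definable₂ ℝ ∅ latticeLang (structR a) S

/-! ### The Büchi structure and its definable copies -/

/-- A two-sorted structure with sorts `N` and `P`, a unary function on `N` and a binary relation
between `N` and `P`. -/
structure BuchiSig (N P : Type*) where
  /-- the unary function on the first sort -/
  succ : N → N
  /-- the relation between the two sorts -/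
  mem : N → P → Prop

/-- The Büchi structure `B = (ℕ, 𝒫(ℕ), s_ℕ, ∈)`. -/
def buchi : BuchiSig ℕ (Set ℕ) where
  succ := fun n => n + 1
  mem := fun t X => t ∈ X

/-- The pair `(h₁, h₂)` is an isomorphism of two-sorted structures. -/
structure BuchiSig.IsIso {N P N' P' : Type*} (A : BuchiSig N P) (B : BuchiSig N' P')
    (h₁ : N → N') (h₂ : P → P') : Prop where
  bijective_fst : Function.Bijective h₁
  bijective_snd : Function.Bijective h₂
  map_succ : ∀ x, h₁ (A.succ x) = B.succ (h₁ x)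
  map_mem : ∀ x c, A.mem x c ↔ B.mem (h₁ x) (h₂ c)

/-- A two-sorted structure whose sorts are sets `S ⊆ M^m` and `T ⊆ M^n` is definable in the
`L`-structure `M`: the sorts, the graph of the function and the relation are definable in `M`
without parameters. -/
structure BuchiSig.IsDefinable (L : FirstOrder.Language) {M : Type*} [L.Structure M] {m n : ℕ}
    {S : Set (Fin m → M)} {T : Set (Fin n → M)} (A : BuchiSig S T) : Prop where
  fst_sort : (∅ : Set M).Definable L S
  snd_sort : (∅ : Set M).Definable L T
  succ : (∅ : Set M).Definable L
    {v : Fin m ⊕ Fin m → M | ∃ x : S, v = Sum.elim (x : Fin m → M) (A.succ x : Fin m → M)}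
  mem : (∅ : Set M).Definable L
    {v : Fin m ⊕ Fin n → M |
      ∃ (x : S) (c : T), A.mem x c ∧ v = Sum.elim (x : Fin m → M) (c : Fin n → M)}

/-- The `L`-structure `M` defines (without parameters) an isomorphic copy of the Büchi
structure. -/
def DefinesCopyOfBuchi (L : FirstOrder.Language) (M : Type*) [L.Structure M] : Prop :=
  ∃ (m n : ℕ) (S : Set (Fin m → M)) (T : Set (Fin n → M)) (A : BuchiSig S T),
    A.IsDefinable L ∧ ∃ (h₁ : S → ℕ) (h₂ : T → Set ℕ), A.IsIso buchi h₁ h₂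

/-! ### Continued fractions, best approximations, Ostrowski digits -/

/-- The partial quotient `a_k` of the continued fraction expansion `[a_0; a_1, a_2, …]` of an
irrational `a`: the integer part of the `k`-th complete quotient. -/
noncomputable def partialQuot (a : ℝ) (k : ℕ) : ℤ :=
  ⌊(fun x : ℝ => (Int.fract x)⁻¹)^[k] a⌋

/-- The denominator `q_k` of the `k`-th convergent `p_k / q_k = [a_0; a_1, …, a_k]` of `a`. -/
noncomputable def convDen (a : ℝ) (k : ℕ) : ℕ := (a.convergent k).den

/-- The numerator `p_k` of the `k`-th convergent of `a`. -/
noncomputable def convNum (a : ℝ) (k : ℕ) : ℤ := (a.convergent k).num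

/-- The `k`-th difference `β_k = q_k a - p_k`. -/
noncomputable def convDiff (a : ℝ) (k : ℕ) : ℝ := convDen a k * a - convNum a k

/-- The set of all pairs `(p, qa)`, with `p, q ∈ ℕ` and `q ≥ 1`, such that `|q'a - p'| > |qa - p|`
for all other `p', q' ∈ ℕ` with `1 ≤ q' ≤ q`. -/
def bestApprox (a : ℝ) : Set (ℝ × ℝ) :=
  {z | ∃ p q : ℕ, 1 ≤ q ∧ z = ((p : ℝ), (q : ℝ) * a) ∧
    ∀ p' q' : ℕ, 1 ≤ q' → q' ≤ q → (p, q) ≠ (p', q') →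
      |(q : ℝ) * a - p| < |(q' : ℝ) * a - p'|}

/-- The projection of the set of best approximations to the second coordinate. -/
def bestDen (a : ℝ) : Set ℝ := Prod.snd '' bestApprox a

/-- `b` is the digit sequence of an Ostrowski representation of `c` based on `a`. Digits are
indexed by the differences they multiply: `c = ∑ b k * β_k`, so `b k` is the digit usually written
`b_{k+1}`. -/
structure IsOstrowski (a : ℝ) (b : ℕ → ℕ) (c : ℝ) : Prop where
  zero_lt : (b 0 : ℤ) < partialQuot a 1
  le : ∀ k, (b k : ℤ) ≤ partialQuot a (k + 1)
  carry : ∀ k, (b (k + 1) : ℤ) = partialQuot a (k + 2) → b k = 0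
  infinite : ∀ n, ∃ k, n ≤ k ∧ Even k ∧ (b k : ℤ) < partialQuot a (k + 1)
  hasSum : HasSum (fun k => (b k : ℝ) * convDiff a k) c

/-- The set of pairs `(q_l a, c)` with `l ≥ 1` and `c ∈ [1 - a, 2 - a)`, such that `i` is the digit
of `c` at `β_l`. -/
def digitRel (a : ℝ) (i : ℕ) : Set (ℝ × ℝ) :=
  {z | z.2 ∈ Set.Ico (1 - a) (2 - a) ∧
    ∃ l b, 1 ≤ l ∧ z.1 = convDen a l * a ∧ IsOstrowski a b z.2 ∧ b l = i}

/-- The set `W` of all `q_l a` with `l` odd. -/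
def oddDen (a : ℝ) : Set ℝ := {x | ∃ l, Odd l ∧ x = convDen a l * a}

/-- The set `J'` of all `c ∈ [1 - a, 2 - a)` whose digit at `β_l` is `0` or `1` for every `l ≥ 1`,
and `0` for every even `l ≥ 1`. -/
def oddDigitSet (a : ℝ) : Set ℝ :=
  {c | c ∈ Set.Ico (1 - a) (2 - a) ∧ ∃ b, IsOstrowski a b c ∧
    ∀ l, 1 ≤ l → (b l = 0 ∨ b l = 1) ∧ (Even l → b l = 0)}

/-! Write B_k = |β_k|, and index digits by the differences they multiply. The point is to express
Ostrowski digits without quantifying over sequences. The pairs (p_k, q_k a) with k ≥ 1 are the best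
approximations (`mem_bestApprox_iff`), a notion that needs only order, addition and the two
lattices. The sign of q_k a − p_k reveals the parity of k, and the next convergent is found through
the order on the q_k a.

Let c have digits b. The single lattice element N a, with N = ∑_{k ≤ l} b_k q_k, encodes the digits
up to l: since ∑_{k < l} b_k q_k < q_l, the digit b_l is the quotient of N by q_l
(`IsOstrowski.digit_iff`). Moreover N is the only integer in [0, q_{l+1}) such that, for some
integer P, c − (N a − P) lies in a certain half-open interval, of length B_l + B_{l+1} if N < q_l
and B_l otherwise. That N has this property is an estimate of the tail of the series
(`IsOstrowski.tailRange`). That no other integer has it is `tailRange_injective`: two candidates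
would produce a difference m a − P too small for its denominator. This gives both the uniqueness of
expansions and the first-order description of digits in `mem_digitRel_iff_exists`; existence of
expansions is a greedy algorithm (`exists_isOstrowski`).

Sequences of digits 0 and 1 that vanish at even positions satisfy all Ostrowski conditions
automatically, so they encode arbitrary subsets of ℕ, with k stored at position 2k + 1
(`exists_buchi_iso`). An arbitrary irrational a is reduced to the range 3/2 < a < 2 by a rational
factor, since definability transfers along the corresponding rescaling (`exists_scale`,
`DefPred.scale`). -/

section ContinuedFraction

/-! ### Continued fractions of irrationals: recursions, signs and best approximation. -/

theorem irrational_fract_inv {x : ℝ} (hx : Irrational x) : Irrational (Int.fract x)⁻¹ := by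
  rw [irrational_inv_iff, Int.fract]
  exact hx.sub_intCast _

theorem fract_pos_of_irrational {x : ℝ} (hx : Irrational x) : 0 < Int.fract x :=
  Int.fract_pos.2 (hx.ne_int _)

theorem one_lt_fract_inv {x : ℝ} (hx : Irrational x) : 1 < (Int.fract x)⁻¹ :=
  (one_lt_inv₀ (fract_pos_of_irrational hx)).2 (Int.fract_lt_one x)

theorem one_le_floor_fract_inv {x : ℝ} (hx : Irrational x) : 1 ≤ ⌊(Int.fract x)⁻¹⌋ :=
  Int.le_floor.2 (by exact_mod_cast (one_lt_fract_inv hx).le)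

theorem partialQuot_zero (x : ℝ) : partialQuot x 0 = ⌊x⌋ := rfl

theorem partialQuot_succ (x : ℝ) (k : ℕ) :
    partialQuot x (k + 1) = partialQuot (Int.fract x)⁻¹ k := rfl

theorem one_le_partialQuot_succ {x : ℝ} (hx : Irrational x) (k : ℕ) :
    1 ≤ partialQuot x (k + 1) := by
  induction k generalizing x with
  | zero => exact one_le_floor_fract_inv hx
  | succ k ih => exact ih (irrational_fract_inv hx)

theorem convNum_zero (x : ℝ) : convNum x 0 = ⌊x⌋ := by simp [convNum]

theorem convDen_zero (x : ℝ) : convDen x 0 = 1 := by simp [convDen]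

/-- The fraction (z · num + den) / num is already reduced and has positive denominator, so both
parts can be read off. This turns the recursion for `Real.convergent` into integer recursions. -/
theorem num_den_int_add_inv (z : ℤ) {r : ℚ} (hr : 0 < r.num) :
    ((z : ℚ) + r⁻¹).num = z * r.num + r.den ∧ (((z : ℚ) + r⁻¹).den : ℤ) = r.num := by
  have h : (z : ℚ) + r⁻¹ = ((z * r.num + r.den : ℤ) : ℚ) / (r.num : ℤ) := by
    have h0 : (r.num : ℚ) ≠ 0 := by exact_mod_cast hr.ne'
    have h1 : (r.den : ℚ) ≠ 0 := by exact_mod_cast r.den_nz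
    have h2 : r⁻¹ = (r.den : ℚ) / r.num := by
      conv_lhs => rw [← Rat.num_div_den r]
      rw [inv_div]
    rw [h2]
    push_cast
    field_simp
  have hc : Nat.Coprime (z * r.num + r.den).natAbs r.num.natAbs := by
    rw [← Int.isCoprime_iff_nat_coprime, add_comm, mul_comm]
    refine IsCoprime.add_mul_left_left ?_ z
    exact (Int.isCoprime_iff_nat_coprime.2 (by simpa using r.reduced)).symm
  rw [h]
  exact ⟨Rat.num_div_eq_of_coprime hr hc, Rat.den_div_eq_of_coprime hr hc⟩

theorem convNum_pos {x : ℝ} (hx : Irrational x) (h : 1 < x) (k : ℕ) : 0 < convNum x k := by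
  induction k generalizing x with
  | zero =>
    rw [convNum_zero]
    exact Int.floor_pos.2 h.le
  | succ k ih =>
    have h1 := ih (irrational_fract_inv hx) (one_lt_fract_inv hx)
    have h2 := (num_den_int_add_inv ⌊x⌋ h1).1
    have h3 : 0 < ⌊x⌋ := Int.floor_pos.2 h.le
    rw [convNum, Real.convergent_succ, h2]
    have := mul_pos h3 h1
    rw [convNum] at this
    positivity

theorem convNum_succ {x : ℝ} (hx : Irrational x) (k : ℕ) :
    convNum x (k + 1) = ⌊x⌋ * convNum (Int.fract x)⁻¹ k + convDen (Int.fract x)⁻¹ k :=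
  (num_den_int_add_inv ⌊x⌋ (convNum_pos (irrational_fract_inv hx) (one_lt_fract_inv hx) k)).1

theorem convDen_succ {x : ℝ} (hx : Irrational x) (k : ℕ) :
    (convDen x (k + 1) : ℤ) = convNum (Int.fract x)⁻¹ k :=
  (num_den_int_add_inv ⌊x⌋ (convNum_pos (irrational_fract_inv hx) (one_lt_fract_inv hx) k)).2

/-- Convergents are defined by unfolding the front of the expansion, whereas the classical recursion
extends it at the back. Induction over all irrational x at once reconciles the two. -/
theorem convNum_convDen_add_two {x : ℝ} (hx : Irrational x) (k : ℕ) :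
    convNum x (k + 2) = partialQuot x (k + 2) * convNum x (k + 1) + convNum x k ∧
    (convDen x (k + 2) : ℤ) = partialQuot x (k + 2) * convDen x (k + 1) + convDen x k := by
  induction k generalizing x with
  | zero =>
    have hx' := irrational_fract_inv hx
    rw [convNum_succ hx (0 + 1), convNum_succ hx 0, convDen_succ hx (0 + 1), convDen_succ hx 0,
      convNum_succ hx' 0, convDen_succ hx' 0, convNum_zero, convNum_zero, convNum_zero, convDen_zero,
      convDen_zero, convDen_zero, partialQuot_succ, partialQuot_succ, partialQuot_zero]
    constructor <;> push_cast <;> ring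
  | succ k ih =>
    have hx' := irrational_fract_inv hx
    obtain ⟨h1, h2⟩ := ih hx'
    rw [convNum_succ hx (k + 2), convNum_succ hx (k + 1), convNum_succ hx k, convDen_succ hx (k + 2),
      convDen_succ hx (k + 1), convDen_succ hx k, h1, h2, partialQuot_succ x (k + 2)]
    constructor <;> ring

theorem convDet {x : ℝ} (hx : Irrational x) (k : ℕ) :
    convNum x k * convDen x (k + 1) - convNum x (k + 1) * convDen x k = -(-1) ^ k := by
  induction k generalizing x with
  | zero =>
    simp only [convNum_succ hx, convDen_succ hx, convNum_zero, convDen_zero]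
    push_cast; ring
  | succ k ih =>
    have h := ih (irrational_fract_inv hx)
    rw [convNum_succ hx (k + 1), convNum_succ hx k, convDen_succ hx (k + 1), convDen_succ hx k,
      pow_succ]
    linear_combination -h

/-- The absolute value of the `k`-th difference. -/
noncomputable def absDiff (x : ℝ) (k : ℕ) : ℝ := (-1) ^ k * convDiff x k

theorem convDiff_eq (x : ℝ) (k : ℕ) : convDiff x k = (-1) ^ k * absDiff x k := by
  rw [absDiff, ← mul_assoc, ← mul_pow]; simp

theorem absDiff_zero (x : ℝ) : absDiff x 0 = Int.fract x := by
  simp [absDiff, convDiff, convDen_zero, convNum_zero]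

/-- Passing to the next complete quotient only rescales the differences by the positive factor
`Int.fract x`; hence their signs alternate. -/
theorem absDiff_succ {x : ℝ} (hx : Irrational x) (k : ℕ) :
    absDiff x (k + 1) = Int.fract x * absDiff (Int.fract x)⁻¹ k := by
  have h := (fract_pos_of_irrational hx).ne'
  have h1 : ((convDen x (k + 1) : ℤ) : ℝ) = convNum (Int.fract x)⁻¹ k := by
    rw [convDen_succ hx]
  simp only [absDiff, convDiff]
  rw [convNum_succ hx, pow_succ]
  push_cast at h1 ⊢
  rw [h1]
  have h2 : x = ⌊x⌋ + Int.fract x := (Int.floor_add_fract x).symm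
  generalize Int.fract x = f at *
  field_simp
  generalize (⌊x⌋ : ℝ) = z at *
  rw [h2]
  ring

theorem absDiff_pos {x : ℝ} (hx : Irrational x) (k : ℕ) : 0 < absDiff x k := by
  induction k generalizing x with
  | zero => rw [absDiff_zero]; exact fract_pos_of_irrational hx
  | succ k ih =>
    rw [absDiff_succ hx]
    exact mul_pos (fract_pos_of_irrational hx) (ih (irrational_fract_inv hx))

theorem absDiff_add_two {x : ℝ} (hx : Irrational x) (k : ℕ) :
    absDiff x k = partialQuot x (k + 2) * absDiff x (k + 1) + absDiff x (k + 2) := by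
  obtain ⟨h1, h2⟩ := convNum_convDen_add_two hx k
  have h2' : ((convDen x (k + 2) : ℤ) : ℝ) =
      ((partialQuot x (k + 2) * convDen x (k + 1) + convDen x k : ℤ) : ℝ) := by rw [h2]
  simp only [absDiff, convDiff]
  rw [h1]
  push_cast at h2' ⊢
  rw [h2', pow_add, pow_add]
  ring

theorem abs_convDiff {x : ℝ} (hx : Irrational x) (k : ℕ) : |convDiff x k| = absDiff x k := by
  rw [convDiff_eq, abs_mul, abs_pow, abs_neg, abs_one, one_pow, one_mul, abs_of_pos (absDiff_pos hx k)]

/-- The best approximation property of the convergents. -/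
theorem absDiff_lt_of_lt_convDen {x : ℝ} (hx : Irrational x) (k : ℕ) {m P : ℤ} (h0 : 0 < m)
    (h1 : m < convDen x (k + 1)) (hne : (P, m) ≠ (convNum x k, (convDen x k : ℤ))) :
    absDiff x k < |m * x - P| := by
  set ε : ℤ := (-1) ^ k with hε
  have hε2 : ε * ε = 1 := by rw [hε, ← mul_pow]; simp
  have hdet := convDet hx k
  rw [← hε] at hdet
  clear_value ε
  -- Integral coordinates of (P, m) in the basis of two consecutive convergents, which exist because
  -- the determinant is ±1.
  obtain ⟨u, hu⟩ : ∃ u, u = ε * (convNum x (k + 1) * m - convDen x (k + 1) * P) := ⟨_, rfl⟩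
  obtain ⟨v, hv⟩ : ∃ v, v = ε * (convDen x k * P - convNum x k * m) := ⟨_, rfl⟩
  have hm : m = u * convDen x k + v * convDen x (k + 1) := by
    rw [hu, hv]
    linear_combination (-m) * hε2 + (ε * m) * hdet
  have hP : P = u * convNum x k + v * convNum x (k + 1) := by
    rw [hu, hv]
    linear_combination (-P) * hε2 + (ε * P) * hdet
  have hval : (m * x - P : ℝ) = (-1) ^ k * (u * absDiff x k - v * absDiff x (k + 1)) := by
    have e : ((-1 : ℝ) ^ k) * (-1) ^ k = 1 := by rw [← mul_pow]; simp
    rw [hm, hP, absDiff, absDiff, convDiff, convDiff, pow_succ]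
    push_cast
    linear_combination (-(u * (convDen x k * x - convNum x k) : ℝ) - v * (convDen x (k + 1) * x - convNum x (k + 1))) * e
  have hB := absDiff_pos hx k
  have hB' := absDiff_pos hx (k + 1)
  rw [hval, abs_mul, abs_pow, abs_neg, abs_one, one_pow, one_mul]
  have hq : (0 : ℤ) < convDen x k := by exact_mod_cast (x.convergent k).den_pos
  have hq' : (0 : ℤ) < convDen x (k + 1) := by exact_mod_cast (x.convergent (k + 1)).den_pos
  -- Because 0 < m < q_{k+1}, either v = 0 and u ≥ 2, or u and v have opposite signs, so the two
  -- terms of `hval` cannot cancel.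
  rcases lt_trichotomy v 0 with hv0 | hv0 | hv0
  · have hu0 : 1 ≤ u := by
      by_contra hcon
      nlinarith
    have a1 : (1 : ℝ) ≤ u := by exact_mod_cast hu0
    have a2 : (v : ℝ) ≤ -1 := by exact_mod_cast (by omega : v ≤ -1)
    refine lt_of_lt_of_le ?_ (le_abs_self _)
    nlinarith
  · rw [hv0] at hm hP
    have hu0 : 1 ≤ u := by
      by_contra hcon
      nlinarith
    have hu1 : u ≠ 1 := by
      rintro rfl
      exact hne (by rw [hm, hP]; simp)
    have a1 : (2 : ℝ) ≤ u := by exact_mod_cast (by omega : 2 ≤ u)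
    refine lt_of_lt_of_le ?_ (le_abs_self _)
    rw [hv0]
    push_cast
    nlinarith
  · have hu0 : u ≤ -1 := by
      by_contra hcon
      nlinarith
    have a1 : (u : ℝ) ≤ -1 := by exact_mod_cast hu0
    have a2 : (1 : ℝ) ≤ v := by exact_mod_cast (by omega : 1 ≤ v)
    refine lt_of_lt_of_le ?_ (neg_le_abs _)
    nlinarith

theorem absDiff_le_of_lt_convDen {x : ℝ} (hx : Irrational x) (k : ℕ) {m P : ℤ} (h0 : 0 < m)
    (h1 : m < convDen x (k + 1)) : absDiff x k ≤ |m * x - P| := by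
  by_cases hne : (P, m) = (convNum x k, (convDen x k : ℤ))
  · simp only [Prod.mk.injEq] at hne
    rw [hne.1, hne.2, ← abs_convDiff hx, convDiff]
    simp
  · exact (absDiff_lt_of_lt_convDen hx k h0 h1 hne).le

theorem convDen_pos (x : ℝ) (k : ℕ) : 0 < convDen x k := (x.convergent k).den_pos

theorem floor_eq_one {a : ℝ} (h1 : 3 / 2 < a) (h2 : a < 2) : ⌊a⌋ = 1 := by
  rw [Int.floor_eq_iff]
  norm_num
  constructor <;> linarith

theorem fract_eq_sub_one {a : ℝ} (h1 : 3 / 2 < a) (h2 : a < 2) : Int.fract a = a - 1 := by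
  rw [Int.fract, floor_eq_one h1 h2]; simp

/-- With a_1 = 1 the digit at β_0 is forced to be 0, and q_0 = q_1 = 1, so that only the indices k ≥
1 matter later. -/
theorem partialQuot_one {a : ℝ} (h1 : 3 / 2 < a) (h2 : a < 2) : partialQuot a 1 = 1 := by
  change ⌊(Int.fract a)⁻¹⌋ = 1
  rw [fract_eq_sub_one h1 h2, Int.floor_eq_iff]
  norm_num
  constructor
  · exact (one_le_inv₀ (by linarith)).2 (by linarith)
  · rw [inv_lt_comm₀ (by linarith) (by norm_num)]; linarith

theorem absDiff_zero_eq {a : ℝ} (h1 : 3 / 2 < a) (h2 : a < 2) :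
    absDiff a 0 = a - 1 := by
  rw [absDiff_zero, fract_eq_sub_one h1 h2]

end ContinuedFraction

/-! ### Best approximations are the convergents of index at least 1. -/

section BestApproximation

variable {a : ℝ} (ha : Irrational a) (h1 : 3 / 2 < a) (h2 : a < 2)
include ha h1 h2

theorem convDen_one : convDen a 1 = 1 := by
  have := convDen_succ ha 0
  rw [convNum_zero] at this
  have h := partialQuot_one h1 h2
  change ⌊(Int.fract a)⁻¹⌋ = 1 at h
  rw [h] at this
  exact_mod_cast this

theorem convNum_one : convNum a 1 = 2 := by
  have := convNum_succ ha 0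
  rw [convNum_zero, convDen_zero, floor_eq_one h1 h2] at this
  have h := partialQuot_one h1 h2
  change ⌊(Int.fract a)⁻¹⌋ = 1 at h
  rw [h] at this
  exact this

theorem absDiff_one : absDiff a 1 = 2 - a := by
  rw [absDiff, convDiff, convDen_one ha h1 h2, convNum_one ha h1 h2]; simp

omit h1 h2 in
theorem convDen_lt_succ (k : ℕ) : convDen a (k + 1) < convDen a (k + 2) := by
  have h := (convNum_convDen_add_two ha k).2
  have h3 := one_le_partialQuot_succ ha (k + 1)
  have h4 := convDen_pos a k
  have h5 := convDen_pos a (k + 1)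
  zify at *
  nlinarith

omit h1 h2 in
theorem convDen_succ_strictMono : StrictMono (fun k => convDen a (k + 1)) :=
  strictMono_nat_of_lt_succ (convDen_lt_succ ha)

omit h1 h2 in
theorem convDen_lt_iff {k l : ℕ} (hk : 1 ≤ k) (hl : 1 ≤ l) :
    convDen a k < convDen a l ↔ k < l := by
  obtain ⟨k, rfl⟩ := Nat.exists_eq_add_of_le' hk
  obtain ⟨l, rfl⟩ := Nat.exists_eq_add_of_le' hl
  simpa using (convDen_succ_strictMono ha).lt_iff_lt (a := k) (b := l)

omit h1 h2 in
theorem convDen_inj {k l : ℕ} (hk : 1 ≤ k) (hl : 1 ≤ l) (h : convDen a k = convDen a l) :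
    k = l := by
  have a1 := convDen_lt_iff ha hk hl
  have a2 := convDen_lt_iff ha hl hk
  omega

/-- If q_k ≤ q < q_{k+1}, a best approximation (p, q) other than the k-th convergent would be
strictly closer than it, which `absDiff_le_of_lt_convDen` excludes. The converse uses the strict
form of that bound, and `convNum_pos` to see that p_k is a natural number. -/
theorem mem_bestApprox_iff (z : ℝ × ℝ) :
    z ∈ bestApprox a ↔ ∃ k, 1 ≤ k ∧ z = ((convNum a k : ℝ), (convDen a k : ℝ) * a) := by
  constructor
  · rintro ⟨p, q, hq, rfl, hbest⟩
    obtain ⟨k, hk1, hk2, hk3⟩ : ∃ k, 1 ≤ k ∧ convDen a k ≤ q ∧ q < convDen a (k + 1) := by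
      have hex : ∃ m, q < convDen a (m + 1) :=
        ⟨q + 1, (convDen_succ_strictMono ha).le_apply (x := q + 1)⟩
      classical
      refine ⟨Nat.find hex, ?_, ?_, Nat.find_spec hex⟩
      · rw [Nat.one_le_iff_ne_zero]
        intro h0
        have := Nat.find_spec hex
        rw [h0, zero_add, convDen_one ha h1 h2] at this
        omega
      · by_contra hlt
        push Not at hlt
        rcases Nat.eq_zero_or_pos (Nat.find hex) with h0 | h0
        · have := Nat.find_spec hex
          rw [h0, zero_add, convDen_one ha h1 h2] at this
          omega
        · have := Nat.find_min hex (m := Nat.find hex - 1) (by omega)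
          rw [Nat.sub_add_cancel h0] at this
          exact this hlt
    refine ⟨k, hk1, ?_⟩
    have hn := convNum_pos ha (by linarith) k
    by_cases hne : (p, q) = ((convNum a k).toNat, convDen a k)
    · simp only [Prod.mk.injEq] at hne
      have : (p : ℤ) = convNum a k := by rw [hne.1]; exact Int.toNat_of_nonneg hn.le
      rw [← this, hne.2]; simp
    · have e1 := hbest _ _ (convDen_pos a k) hk2 hne
      have e2 : (((convNum a k).toNat : ℕ) : ℝ) = convNum a k := by
        exact_mod_cast Int.toNat_of_nonneg hn.le
      rw [e2] at e1
      have e3 := abs_convDiff ha k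
      rw [convDiff] at e3
      rw [e3] at e1
      have e4 := absDiff_le_of_lt_convDen ha k (m := q) (P := p) (by omega) (by exact_mod_cast hk3)
      push_cast at e4
      linarith
  · rintro ⟨k, hk, rfl⟩
    have hn := convNum_pos ha (by linarith) k
    have e2 : (((convNum a k).toNat : ℕ) : ℝ) = convNum a k := by
      exact_mod_cast Int.toNat_of_nonneg hn.le
    refine ⟨(convNum a k).toNat, convDen a k, convDen_pos a k, by rw [e2], ?_⟩
    intro p' q' hq' hle hne
    have e3 := abs_convDiff ha k
    rw [convDiff] at e3
    rw [e2, e3]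
    have hlt : q' < convDen a (k + 1) :=
      hle.trans_lt ((convDen_lt_iff ha hk (by omega)).2 (by omega))
    have := absDiff_lt_of_lt_convDen ha k (m := q') (P := p') (by omega) (by exact_mod_cast hlt) ?_
    · exact_mod_cast this
    · intro h
      simp only [Prod.mk.injEq, Nat.cast_inj] at h
      apply hne
      rw [← h.1, ← h.2]; simp

theorem bestDen_eq : bestDen a = {x | ∃ k : ℕ, 1 ≤ k ∧ x = convDen a k * a} := by
  ext x
  simp only [bestDen, Set.mem_image, mem_bestApprox_iff ha h1 h2]
  constructor
  · rintro ⟨z, ⟨k, hk, rfl⟩, rfl⟩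
    exact ⟨k, hk, rfl⟩
  · rintro ⟨k, hk, rfl⟩
    exact ⟨_, ⟨k, hk, rfl⟩, rfl⟩

end BestApproximation

/-! ### Ostrowski numeration: remainders, uniqueness and existence of digits. -/

section OstrowskiNumeration

open Finset Filter Topology

/-- The remainder of the representation with digits `b`, with the sign of the `l`-th difference. -/
noncomputable def ostrowskiTail (a : ℝ) (b : ℕ → ℕ) (c : ℝ) (l : ℕ) : ℝ :=
  (-1) ^ l * (c - ∑ k ∈ range l, (b k : ℝ) * convDiff a k)

theorem ostrowskiTail_succ (a : ℝ) (b : ℕ → ℕ) (c : ℝ) (l : ℕ) :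
    ostrowskiTail a b c (l + 1) = b l * absDiff a l - ostrowskiTail a b c l := by
  simp only [ostrowskiTail, absDiff, sum_range_succ, pow_succ]
  ring

/-- The range of the remainders at `m + 1`; the upper bound is diminished by `e`. -/
def TailRange (a : ℝ) (m : ℕ) (e u : ℝ) : Prop :=
  (Odd m → -absDiff a (m + 1) ≤ u ∧ u < absDiff a m - e) ∧
  (Even m → -absDiff a (m + 1) < u ∧ u ≤ absDiff a m - e)

theorem TailRange.weak {a : ℝ} {m : ℕ} {e u : ℝ} (h : TailRange a m e u) :
    -absDiff a (m + 1) ≤ u ∧ u ≤ absDiff a m - e := by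
  rcases Nat.even_or_odd m with hm | hm
  · exact ⟨(h.2 hm).1.le, (h.2 hm).2⟩
  · exact ⟨(h.1 hm).1, (h.1 hm).2.le⟩

theorem TailRange.sub_lt {a : ℝ} {m : ℕ} {e u e' u' : ℝ} (h : TailRange a m e u)
    (h' : TailRange a m e' u') : u - u' < absDiff a m - e + absDiff a (m + 1) := by
  rcases Nat.even_or_odd m with hm | hm
  · linarith [(h.2 hm).2, (h'.2 hm).1]
  · linarith [(h.1 hm).2, (h'.1 hm).1]

variable {a : ℝ}

theorem absDiff_succ_add_le (ha : Irrational a) (k : ℕ) :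
    absDiff a (k + 1) + absDiff a (k + 2) ≤ absDiff a k := by
  have h := absDiff_add_two ha k
  have h1 : (1 : ℝ) ≤ partialQuot a (k + 2) := by
    exact_mod_cast one_le_partialQuot_succ ha (k + 1)
  nlinarith [absDiff_pos ha (k + 1)]

theorem absDiff_succ_le (ha : Irrational a) (k : ℕ) : absDiff a (k + 1) ≤ absDiff a k := by
  linarith [absDiff_succ_add_le ha k, absDiff_pos ha (k + 2)]

/-- The sequence decreases to some L ≥ 0, and B_{k+1} + B_{k+2} ≤ B_k gives 2L ≤ L. -/
theorem tendsto_absDiff (ha : Irrational a) : Tendsto (absDiff a) atTop (𝓝 0) := by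
  have hanti : Antitone (absDiff a) := antitone_nat_of_succ_le (absDiff_succ_le ha)
  have hbdd : BddBelow (Set.range (absDiff a)) :=
    ⟨0, by rintro _ ⟨k, rfl⟩; exact (absDiff_pos ha k).le⟩
  have hlim := tendsto_atTop_ciInf hanti hbdd
  set L := ⨅ i, absDiff a i
  have h0 : 0 ≤ L := ge_of_tendsto' hlim (fun k => (absDiff_pos ha k).le)
  have h1 := le_of_tendsto_of_tendsto' (((tendsto_add_atTop_iff_nat 1).2 hlim).add
    ((tendsto_add_atTop_iff_nat 2).2 hlim)) hlim (absDiff_succ_add_le ha)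
  have : L = 0 := by linarith
  rwa [this] at hlim

/-- The bounds are pulled back through v_l = b_l B_l − v_{l+1} from an index at distance n where |v|
≤ ε. The error does not grow on the way, so letting ε tend to 0 gives exact bounds for a convergent
expansion. -/
theorem tail_bounds_of_abs_le (ha : Irrational a) {b : ℕ → ℕ}
    (hle : ∀ k, (b k : ℤ) ≤ partialQuot a (k + 1))
    (hcarry : ∀ k, (b (k + 1) : ℤ) = partialQuot a (k + 2) → b k = 0) {v : ℕ → ℝ}
    (hv : ∀ l, v (l + 1) = b l * absDiff a l - v l) {ε : ℝ} (n : ℕ) :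
    ∀ j, |v (j + 1 + n)| ≤ ε → -absDiff a (j + 1) - ε ≤ v (j + 1) ∧ v (j + 1) ≤ absDiff a j + ε ∧
      ((b (j + 1) : ℤ) < partialQuot a (j + 2) →
        v (j + 1) ≤ absDiff a j - absDiff a (j + 1) + ε) := by
  induction n with
  | zero =>
    intro j h
    rw [add_zero, abs_le] at h
    have h1 := absDiff_pos ha j
    have h2 := absDiff_pos ha (j + 1)
    have h3 := absDiff_succ_le ha j
    exact ⟨by linarith, by linarith, fun _ => by linarith⟩
  | succ n ih =>
    intro j h
    obtain ⟨i1, i2, i3⟩ := ih (j + 1) (by rwa [show j + 1 + 1 + n = j + 1 + (n + 1) by ring])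
    have hv1 := hv (j + 1)
    have hB := absDiff_add_two ha j
    have h2 := absDiff_pos ha (j + 1)
    have h4 := absDiff_pos ha (j + 2)
    have hb : (b (j + 1) : ℝ) ≤ partialQuot a (j + 2) := by exact_mod_cast hle (j + 1)
    refine ⟨?_, ?_, ?_⟩
    · rcases Nat.eq_zero_or_pos (b (j + 1)) with h0 | h0
      · rw [h0] at hv1
        push_cast at hv1
        linarith
      · have hlt : (b (j + 2) : ℤ) < partialQuot a (j + 3) :=
          lt_of_le_of_ne (hle (j + 2)) (fun hh => h0.ne' (hcarry (j + 1) hh))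
        have i4 := i3 hlt
        have h0' : (1 : ℝ) ≤ b (j + 1) := by exact_mod_cast h0
        nlinarith
    · nlinarith
    · intro hlt
      have hb' : (b (j + 1) : ℝ) ≤ partialQuot a (j + 2) - 1 := by
        exact_mod_cast Int.le_sub_one_of_lt hlt
      nlinarith

theorem IsOstrowski.tendsto_tail {b : ℕ → ℕ} {c : ℝ} (h : IsOstrowski a b c) :
    Tendsto (ostrowskiTail a b c) atTop (𝓝 0) := by
  have h1 := (tendsto_const_nhds (x := c)).sub h.hasSum.tendsto_sum_nat
  rw [sub_self] at h1
  rw [tendsto_zero_iff_abs_tendsto_zero] at h1 ⊢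
  refine h1.congr (fun l => ?_)
  simp [ostrowskiTail, abs_mul]

theorem IsOstrowski.tail_bounds (ha : Irrational a) {b : ℕ → ℕ} {c : ℝ} (h : IsOstrowski a b c)
    (j : ℕ) : -absDiff a (j + 1) ≤ ostrowskiTail a b c (j + 1) ∧
      ostrowskiTail a b c (j + 1) ≤ absDiff a j ∧
      ((b (j + 1) : ℤ) < partialQuot a (j + 2) →
        ostrowskiTail a b c (j + 1) ≤ absDiff a j - absDiff a (j + 1)) := by
  have key : ∀ ε : ℝ, 0 < ε → ∃ n, |ostrowskiTail a b c (j + 1 + n)| ≤ ε := fun ε hε => by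
    obtain ⟨N, hN⟩ := Metric.tendsto_atTop.1 h.tendsto_tail ε hε
    have := hN (j + 1 + N) (by omega)
    rw [Real.dist_eq, sub_zero] at this
    exact ⟨N, this.le⟩
  replace key := fun ε hε => (key ε hε).elim fun n hn =>
    tail_bounds_of_abs_le ha h.le h.carry (ostrowskiTail_succ a b c) n j hn
  refine ⟨le_of_forall_pos_le_add fun ε hε => ?_, le_of_forall_pos_le_add fun ε hε => ?_,
    fun hlt => le_of_forall_pos_le_add fun ε hε => ?_⟩
  · linarith [(key ε hε).1]
  · exact (key ε hε).2.1
  · exact (key ε hε).2.2 hlt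

/-- Reaching B_j would force a maximal digit at j + 1 and again reach B_{j+2} two steps later. All
even digits from j + 1 on would be maximal, against `infinite`. -/
theorem IsOstrowski.tail_lt (ha : Irrational a) {b : ℕ → ℕ} {c : ℝ} (h : IsOstrowski a b c)
    {j : ℕ} (hj : Odd j) : ostrowskiTail a b c (j + 1) < absDiff a j := by
  by_contra hcon
  have step : ∀ i, absDiff a i ≤ ostrowskiTail a b c (i + 1) →
      (b (i + 1) : ℤ) = partialQuot a (i + 2) ∧
        absDiff a (i + 2) ≤ ostrowskiTail a b c (i + 2 + 1) := by
    intro i hi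
    have h1 := h.tail_bounds ha i
    have hB := absDiff_pos ha (i + 1)
    have hB2 := absDiff_pos ha (i + 2)
    have e : (b (i + 1) : ℤ) = partialQuot a (i + 2) := by
      by_contra hne
      have := h1.2.2 (lt_of_le_of_ne (h.le (i + 1)) hne)
      linarith
    refine ⟨e, ?_⟩
    have e' : (b (i + 1) : ℝ) = partialQuot a (i + 2) := by exact_mod_cast e
    have h2 := ostrowskiTail_succ a b c (i + 1)
    have h3 := ostrowskiTail_succ a b c (i + 2)
    have h4 := absDiff_add_two ha i
    rw [e'] at h2
    have h5 : (0 : ℝ) ≤ b (i + 2) * absDiff a (i + 2) := by positivity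
    linarith
  have all : ∀ n, absDiff a (j + 2 * n) ≤ ostrowskiTail a b c (j + 2 * n + 1) := by
    intro n
    induction n with
    | zero => simpa using hcon
    | succ n ih => exact (step _ ih).2
  obtain ⟨k, hk1, hk2, hk3⟩ := h.infinite (j + 1)
  obtain ⟨n, hn⟩ : ∃ n, k = j + 2 * n + 1 := by
    obtain ⟨x, rfl⟩ := hj
    obtain ⟨y, rfl⟩ := hk2
    exact ⟨y - x - 1, by omega⟩
  rw [hn] at hk3
  have := (step _ (all n)).1
  rw [show j + 2 * n + 1 + 1 = j + 2 * n + 2 by ring] at hk3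
  omega

theorem IsOstrowski.lt_tail (ha : Irrational a) {b : ℕ → ℕ} {c : ℝ} (h : IsOstrowski a b c)
    {j : ℕ} (hj : Even j) : -absDiff a (j + 1) < ostrowskiTail a b c (j + 1) := by
  by_contra hcon
  have h1 := h.tail_lt ha (hj.add_one)
  rw [ostrowskiTail_succ a b c (j + 1)] at h1
  have h5 : (0 : ℝ) ≤ b (j + 1) * absDiff a (j + 1) := by
    have := absDiff_pos ha (j + 1)
    positivity
  linarith

/-- Once the sign (−1)^(j+1) is undone, c minus its partial sum lies in an interval closed on the
left and open on the right, for either parity of j. A nonzero digit at j forbids a maximal digit at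
j + 1, which shortens the interval by B_{j+1}. -/
theorem IsOstrowski.tailRange (ha : Irrational a) {b : ℕ → ℕ} {c : ℝ} (h : IsOstrowski a b c)
    (j : ℕ) :
    TailRange a j (if b j = 0 then 0 else absDiff a (j + 1)) (ostrowskiTail a b c (j + 1)) := by
  have hb := h.tail_bounds ha j
  have hlt : b j ≠ 0 → (b (j + 1) : ℤ) < partialQuot a (j + 2) := fun h0 =>
    lt_of_le_of_ne (h.le (j + 1)) (fun hh => h0 (h.carry j hh))
  refine ⟨fun hj => ⟨hb.1, ?_⟩, fun hj => ⟨h.lt_tail ha hj, ?_⟩⟩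
  · split_ifs with h0
    · rw [sub_zero]; exact h.tail_lt ha hj
    · have h1 := ostrowskiTail_succ a b c (j + 1)
      have h2 := h.lt_tail ha hj.add_one
      have h3 : (b (j + 1) : ℝ) ≤ partialQuot a (j + 2) - 1 := by
        exact_mod_cast Int.le_sub_one_of_lt (hlt h0)
      have h4 := absDiff_add_two ha j
      have h5 := absDiff_pos ha (j + 1)
      nlinarith
  · split_ifs with h0
    · rw [sub_zero]; exact hb.2.1
    · exact hb.2.2 (hlt h0)

/-- The natural number whose Ostrowski digits are the first `l` terms of `b`. -/
noncomputable def ostrowskiTrunc (a : ℝ) (b : ℕ → ℕ) (l : ℕ) : ℕ :=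
  ∑ k ∈ range l, b k * convDen a k

theorem ostrowskiTrunc_succ (a : ℝ) (b : ℕ → ℕ) (l : ℕ) :
    ostrowskiTrunc a b (l + 1) = ostrowskiTrunc a b l + b l * convDen a l := sum_range_succ _ _

theorem convDen_add_two (ha : Irrational a) (k : ℕ) :
    (convDen a (k + 2) : ℤ) = partialQuot a (k + 2) * convDen a (k + 1) + convDen a k :=
  (convNum_convDen_add_two ha k).2

/-- The carry rule makes this work: below a maximal digit stands a 0, so the bound two indices down
suffices. -/
theorem IsOstrowski.trunc_lt (ha : Irrational a) {b : ℕ → ℕ} {c : ℝ} (h : IsOstrowski a b c) :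
    ∀ l, ostrowskiTrunc a b l < convDen a l
  | 0 => by simp [ostrowskiTrunc, convDen_zero]
  | 1 => by
    have h0 := h.zero_lt
    have h1 : (convDen a 1 : ℤ) = partialQuot a 1 := by
      rw [convDen_succ ha 0, convNum_zero]; rfl
    rw [← h1] at h0
    simp only [ostrowskiTrunc, sum_range_one, convDen_zero, mul_one]
    exact_mod_cast h0
  | l + 2 => by
    have i1 := h.trunc_lt ha (l + 1)
    have i0 := h.trunc_lt ha l
    have hq := convDen_add_two ha l
    have hq1 := convDen_pos a (l + 1)
    have hq0 := convDen_pos a l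
    rw [ostrowskiTrunc_succ]
    zify at *
    by_cases hb : (b (l + 1) : ℤ) = partialQuot a (l + 2)
    · have h0 := h.carry l hb
      have e := ostrowskiTrunc_succ a b l
      rw [h0, zero_mul, add_zero] at e
      rw [hq, ← hb, e]
      linarith
    · have hlt := lt_of_le_of_ne (h.le (l + 1)) hb
      nlinarith

theorem IsOstrowski.convDen_le_trunc_iff (ha : Irrational a) {b : ℕ → ℕ} {c : ℝ}
    (h : IsOstrowski a b c) (j : ℕ) : convDen a j ≤ ostrowskiTrunc a b (j + 1) ↔ b j ≠ 0 := by
  have h1 := h.trunc_lt ha j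
  rw [ostrowskiTrunc_succ]
  constructor
  · intro h2 h0
    rw [h0] at h2
    omega
  · intro h0
    exact le_add_left (Nat.le_mul_of_pos_left _ (Nat.pos_of_ne_zero h0))

/-- The lower digits contribute less than q_j, so the digit is a quotient. The two inequalities
survive multiplication by a and are then first-order. -/
theorem IsOstrowski.digit_iff (ha : Irrational a) {b : ℕ → ℕ} {c : ℝ}
    (h : IsOstrowski a b c) (j i : ℕ) : b j = i ↔
      i * convDen a j ≤ ostrowskiTrunc a b (j + 1) ∧
        ostrowskiTrunc a b (j + 1) < (i + 1) * convDen a j := by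
  have h1 := h.trunc_lt ha j
  rw [ostrowskiTrunc_succ]
  constructor
  · rintro rfl
    constructor <;> nlinarith
  · rintro ⟨h2, h3⟩
    have a1 : i < b j + 1 := by
      by_contra hc
      push Not at hc
      nlinarith
    have a2 : b j < i + 1 := by
      by_contra hc
      push Not at hc
      nlinarith
    omega

theorem absDiff_le_abs_of_natAbs_lt (ha : Irrational a) (k : ℕ) {m P : ℤ} (h0 : m ≠ 0)
    (h1 : |m| < convDen a (k + 1)) : absDiff a k ≤ |m * a - P| := by
  rcases lt_or_gt_of_ne h0 with h | h
  · rw [abs_of_neg h] at h1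
    have := absDiff_le_of_lt_convDen ha k (m := -m) (P := -P) (by omega) h1
    rw [← abs_neg]
    convert this using 2
    push_cast
    ring
  · rw [abs_of_pos h] at h1
    exact absDiff_le_of_lt_convDen ha k h h1

/-- If n ≠ n', the difference of the two remainders is, up to sign, (n' − n) a − (P' − P), hence at
least B_j by best approximation. It is also smaller than the length of the interval attached to n,
which is already absurd when n ≥ q_j. Only the lower end of the range is used for n', so `e'` is
arbitrary. -/
theorem tailRange_injective_aux (ha : Irrational a) {j : ℕ} {n n' P P' : ℤ} {c : ℝ}
    (hn0 : 0 ≤ n) (hn : n < convDen a (j + 1)) (hn0' : 0 ≤ n') (hn' : n' < convDen a (j + 1))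
    {e' : ℝ}
    (h : TailRange a j (if n < convDen a j then 0 else absDiff a (j + 1))
      ((-1) ^ (j + 1) * (c - (n * a - P))))
    (h' : TailRange a j e' ((-1) ^ (j + 1) * (c - (n' * a - P'))))
    (hle : (-1) ^ (j + 1) * (c - (n' * a - P')) ≤ (-1) ^ (j + 1) * (c - (n * a - P))) :
    n = n' := by
  by_contra hne
  have h1 := h.sub_lt h'
  have h2 := absDiff_le_abs_of_natAbs_lt ha j (m := n' - n) (P := P' - P) (by omega)
    (by rw [abs_lt]; omega)
  have e1 : (-1) ^ (j + 1) * (c - (n * a - P)) - (-1) ^ (j + 1) * (c - (n' * a - P')) =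
      (-1) ^ (j + 1) * (((n' - n : ℤ) : ℝ) * a - ((P' - P : ℤ) : ℝ)) := by push_cast; ring
  have e2 : |((n' - n : ℤ) : ℝ) * a - ((P' - P : ℤ) : ℝ)| =
      (-1) ^ (j + 1) * (((n' - n : ℤ) : ℝ) * a - ((P' - P : ℤ) : ℝ)) := by
    rw [← e1, ← abs_of_nonneg (sub_nonneg.2 hle), e1, abs_mul]
    simp
  rw [e1] at h1
  rw [e2] at h2
  split_ifs at h1 with hlt
  -- For n < q_j the interval is longer than B_j. Subtracting B_j moves the denominator to n' − n +
  -- q_j, which lies strictly between 0 and q_{j+2}, and leaves a value in [0, B_{j+1}): too small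
  -- at level j + 1.
  · have e3 : absDiff a j = -(-1) ^ (j + 1) * (convDen a j * a - convNum a j) := by
      rw [absDiff, convDiff, pow_succ]; ring
    have h3 := absDiff_le_of_lt_convDen ha (j + 1) (m := n' - n + convDen a j)
      (P := P' - P + convNum a j) (by omega) (by
        have hq := convDen_add_two ha j
        have := one_le_partialQuot_succ ha (j + 1)
        have := convDen_pos a (j + 1)
        have : (0 : ℤ) < convDen a (j + 1) := by exact_mod_cast this
        change n' - n + convDen a j < (convDen a (j + 2) : ℤ)
        nlinarith)
    have e4 : (-1) ^ (j + 1) * (((n' - n : ℤ) : ℝ) * a - ((P' - P : ℤ) : ℝ)) - absDiff a j =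
        (-1) ^ (j + 1) * (((n' - n + convDen a j : ℤ) : ℝ) * a - ((P' - P + convNum a j : ℤ) : ℝ)) := by
      rw [e3]; push_cast; ring
    have e5 : |((n' - n + convDen a j : ℤ) : ℝ) * a - ((P' - P + convNum a j : ℤ) : ℝ)| =
        (-1) ^ (j + 1) * (((n' - n + convDen a j : ℤ) : ℝ) * a -
          ((P' - P + convNum a j : ℤ) : ℝ)) := by
      rw [← e4, ← abs_of_nonneg (sub_nonneg.2 h2), e4, abs_mul]
      simp
    rw [e5, ← e4] at h3
    linarith
  · linarith

/-- The remainder range at `j + 1` determines the truncation among the numbers below `q_{j+1}`. -/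
theorem tailRange_injective (ha : Irrational a) {j : ℕ} {n n' P P' : ℤ} {c : ℝ}
    (hn0 : 0 ≤ n) (hn : n < convDen a (j + 1)) (hn0' : 0 ≤ n') (hn' : n' < convDen a (j + 1))
    (h : TailRange a j (if n < convDen a j then 0 else absDiff a (j + 1))
      ((-1) ^ (j + 1) * (c - (n * a - P))))
    (h' : TailRange a j (if n' < convDen a j then 0 else absDiff a (j + 1))
      ((-1) ^ (j + 1) * (c - (n' * a - P')))) : n = n' := by
  rcases le_total ((-1) ^ (j + 1) * (c - (n' * a - P')))
    ((-1) ^ (j + 1) * (c - (n * a - P))) with hle | hle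
  · exact tailRange_injective_aux ha hn0 hn hn0' hn' h h' hle
  · exact (tailRange_injective_aux ha hn0' hn' hn0 hn h' h hle).symm

theorem IsOstrowski.exists_tailRange (ha : Irrational a) {b : ℕ → ℕ} {c : ℝ}
    (h : IsOstrowski a b c) (j : ℕ) : ∃ P : ℤ,
      TailRange a j (if (ostrowskiTrunc a b (j + 1) : ℤ) < convDen a j then 0 else absDiff a (j + 1))
      ((-1) ^ (j + 1) * (c - (((ostrowskiTrunc a b (j + 1) : ℤ) : ℝ) * a - P))) := by
  refine ⟨∑ k ∈ range (j + 1), b k * convNum a k, ?_⟩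
  have h1 := h.tailRange ha j
  have h2 := h.convDen_le_trunc_iff ha j
  have e1 : (if (ostrowskiTrunc a b (j + 1) : ℤ) < convDen a j then (0 : ℝ) else absDiff a (j + 1)) =
      if b j = 0 then 0 else absDiff a (j + 1) := by
    congr 1
    rw [eq_iff_iff]
    have : ((ostrowskiTrunc a b (j + 1) : ℤ) < convDen a j) ↔
        ostrowskiTrunc a b (j + 1) < convDen a j := by exact_mod_cast Iff.rfl
    rw [this, ← not_le, h2, not_not]
  rw [e1]
  convert h1 using 1
  rw [ostrowskiTail, ostrowskiTrunc]
  congr 2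
  push_cast
  rw [sum_mul, ← sum_sub_distrib]
  refine sum_congr rfl fun k _ => ?_
  rw [convDiff]
  ring

theorem IsOstrowski.eq_trunc (ha : Irrational a) {b : ℕ → ℕ} {c : ℝ}
    (h : IsOstrowski a b c) (j : ℕ) {n P : ℤ} (hn0 : 0 ≤ n) (hn : n < convDen a (j + 1))
    (ht : TailRange a j (if n < convDen a j then 0 else absDiff a (j + 1))
      ((-1) ^ (j + 1) * (c - (n * a - P)))) : n = ostrowskiTrunc a b (j + 1) := by
  obtain ⟨P', hP'⟩ := h.exists_tailRange ha j
  exact tailRange_injective ha hn0 hn (by positivity) (by exact_mod_cast h.trunc_lt ha (j + 1)) ht hP'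

theorem IsOstrowski.unique (ha : Irrational a) {b b' : ℕ → ℕ} {c : ℝ}
    (h : IsOstrowski a b c) (h' : IsOstrowski a b' c) : b = b' := by
  funext j
  have e : ostrowskiTrunc a b (j + 1) = ostrowskiTrunc a b' (j + 1) := by
    obtain ⟨P, hP⟩ := h.exists_tailRange ha j
    exact_mod_cast h'.eq_trunc ha j (by positivity) (by exact_mod_cast h.trunc_lt ha (j + 1)) hP
  rw [h.digit_iff ha, e]
  exact (h'.digit_iff ha j _).1 rfl

theorem summable_digits (ha : Irrational a) {b : ℕ → ℕ}
    (hle : ∀ k, (b k : ℤ) ≤ partialQuot a (k + 1)) :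
    Summable (fun k => (b k : ℝ) * convDiff a k) := by
  have hs : Summable (fun k => (b (k + 1) : ℝ) * absDiff a (k + 1)) := by
    refine summable_of_sum_range_le (c := absDiff a 0 + absDiff a 1) (fun k => ?_) (fun n => ?_)
    · have := absDiff_pos ha (k + 1)
      positivity
    -- Each term is at most B_n − B_{n+2}; the sum telescopes in steps of two, which leaves two
    -- boundary terms at each end.
    · suffices H : ∑ k ∈ range n, (b (k + 1) : ℝ) * absDiff a (k + 1) ≤
          absDiff a 0 + absDiff a 1 - absDiff a n - absDiff a (n + 1) by
        linarith [absDiff_pos ha n, absDiff_pos ha (n + 1)]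
      induction n with
      | zero => simp
      | succ n ih =>
        rw [sum_range_succ]
        have h1 := absDiff_add_two ha n
        have h2 : (b (n + 1) : ℝ) ≤ partialQuot a (n + 2) := by exact_mod_cast hle (n + 1)
        nlinarith [absDiff_pos ha (n + 1)]
  rw [← summable_nat_add_iff 1]
  refine Summable.of_norm (hs.congr fun k => ?_)
  rw [norm_mul, Real.norm_eq_abs, Real.norm_eq_abs, abs_convDiff ha, Nat.abs_cast]

section Interval

variable (ha : Irrational a) (h1 : 3 / 2 < a) (h2 : a < 2)
include ha h1 h2

omit ha in
theorem IsOstrowski.zero_eq_zero {b : ℕ → ℕ} {c : ℝ} (h : IsOstrowski a b c) : b 0 = 0 := by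
  have := h.zero_lt
  rw [partialQuot_one h1 h2] at this
  omega

theorem IsOstrowski.mem_Ico {b : ℕ → ℕ} {c : ℝ} (h : IsOstrowski a b c) :
    c ∈ Set.Ico (1 - a) (2 - a) := by
  have h3 := (h.tailRange ha 0).2 Even.zero
  have h4 := h.zero_eq_zero h1 h2
  simp only [ostrowskiTail, zero_add, sum_range_one, h4, absDiff_one ha h1 h2,
    absDiff_zero_eq h1 h2] at h3
  norm_num at h3
  exact ⟨by linarith, by linarith⟩

/-- Zeros at the even positions make the carry rule and the infinitude condition automatic, because
the partial quotients after the zeroth are at least 1. The odd positions are left free to encode a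
set. -/
theorem exists_isOstrowski_of_digits {b : ℕ → ℕ} (h0 : b 0 = 0) (hb : ∀ k, b k = 0 ∨ b k = 1)
    (he : ∀ k, Even k → b k = 0) : ∃ c, IsOstrowski a b c := by
  have hle : ∀ k, (b k : ℤ) ≤ partialQuot a (k + 1) := fun k => by
    have := one_le_partialQuot_succ ha k
    rcases hb k with h | h <;> rw [h] <;> push_cast <;> omega
  refine ⟨_, ?_, hle, ?_, ?_, (summable_digits ha hle).hasSum⟩
  · rw [h0, partialQuot_one h1 h2]; norm_num
  · intro k hk
    rcases Nat.even_or_odd k with h | h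
    · exact he k h
    · rw [he (k + 1) h.add_one] at hk
      have : 1 ≤ partialQuot a (k + 2) := one_le_partialQuot_succ ha (k + 1)
      push_cast at hk
      omega
  · intro n
    refine ⟨2 * n, by omega, even_two_mul n, ?_⟩
    have := one_le_partialQuot_succ ha (2 * n)
    rw [he _ (even_two_mul n)]
    push_cast
    omega

end Interval

/-- Greedy step: d is the least digit that keeps the next remainder above its lower end. Its upper
bound comes from minimality if d > 0, and from the lower bound on v if d = 0. The digit is chosen
before e, so it is a function of j and v alone and can be iterated. -/
theorem exists_digit (ha : Irrational a) (j : ℕ) (v : ℝ) : ∃ d : ℕ,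
    ∀ e, TailRange a j e v → 0 ≤ e →
      (d : ℤ) ≤ partialQuot a (j + 2) ∧
      (e = absDiff a (j + 1) → (d : ℤ) < partialQuot a (j + 2)) ∧
      TailRange a (j + 1) (if d = 0 then 0 else absDiff a (j + 2)) (d * absDiff a (j + 1) - v) := by
  have hB := absDiff_pos ha (j + 1)
  have hB2 := absDiff_pos ha (j + 2)
  have hr := absDiff_add_two ha j
  have hA : 1 ≤ partialQuot a (j + 2) := one_le_partialQuot_succ ha (j + 1)
  classical
  -- Whether the comparison is strict follows the endpoint convention of `TailRange` at j + 1, whose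
  -- parity is opposite to that of j.
  obtain ⟨d, hd⟩ : ∃ d : ℕ, (Even j → -absDiff a (j + 2) ≤ d * absDiff a (j + 1) - v ∧
        ∀ m : ℕ, -absDiff a (j + 2) ≤ m * absDiff a (j + 1) - v → d ≤ m) ∧
      (Odd j → -absDiff a (j + 2) < d * absDiff a (j + 1) - v ∧
        ∀ m : ℕ, -absDiff a (j + 2) < m * absDiff a (j + 1) - v → d ≤ m) := by
    have hex : ∃ d : ℕ, -absDiff a (j + 2) < d * absDiff a (j + 1) - v := by
      obtain ⟨d, hd⟩ := exists_nat_gt (v / absDiff a (j + 1))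
      rw [div_lt_iff₀ hB] at hd
      exact ⟨d, by linarith⟩
    have hex' : ∃ d : ℕ, -absDiff a (j + 2) ≤ d * absDiff a (j + 1) - v :=
      hex.imp fun d hd => hd.le
    rcases Nat.even_or_odd j with h | h
    · exact ⟨Nat.find hex', fun _ => ⟨Nat.find_spec hex', fun m hm => Nat.find_min' hex' hm⟩,
        fun h' => absurd h (Nat.not_even_iff_odd.2 h')⟩
    · exact ⟨Nat.find hex, fun h' => absurd h' (Nat.not_even_iff_odd.2 h),
        fun _ => ⟨Nat.find_spec hex, fun m hm => Nat.find_min' hex hm⟩⟩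
  refine ⟨d, fun e he he0 => ?_⟩
  obtain ⟨A, hA'⟩ := Int.eq_ofNat_of_zero_le (by omega : 0 ≤ partialQuot a (j + 2))
  rw [hA'] at hr hA ⊢
  push_cast at hr
  have hA1 : ((A - 1 : ℕ) : ℝ) = A - 1 := by
    rw [Nat.cast_sub (by omega)]; simp
  rcases Nat.even_or_odd j with h | h
  · obtain ⟨g1, g2⟩ := hd.1 h
    obtain ⟨e1, e2⟩ := he.2 h
    refine ⟨?_, ?_, fun _ => ⟨g1, ?_⟩, fun h' => ?_⟩
    · have := g2 A (by linarith)
      exact_mod_cast this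
    · intro hee
      have := g2 (A - 1) (by rw [hA1]; linarith)
      omega
    · split_ifs with hd0
      · rw [hd0]; push_cast; linarith
      · have : ¬ d ≤ d - 1 := by omega
        have := mt (g2 (d - 1)) this
        rw [Nat.cast_sub (by omega)] at this
        push_cast at this
        rw [show j + 1 + 1 = j + 2 from rfl]
        linarith
    · exact absurd h (by simpa [Nat.even_add_one] using h')
  · obtain ⟨g1, g2⟩ := hd.2 h
    obtain ⟨e1, e2⟩ := he.1 h
    refine ⟨?_, ?_, fun h' => ?_, fun _ => ⟨g1, ?_⟩⟩
    · have := g2 A (by linarith)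
      exact_mod_cast this
    · intro hee
      have := g2 (A - 1) (by rw [hA1]; linarith)
      omega
    · exact absurd h.add_one (Nat.not_even_iff_odd.2 h')
    · split_ifs with hd0
      · rw [hd0]; push_cast; linarith
      · have : ¬ d ≤ d - 1 := by omega
        have := mt (g2 (d - 1)) this
        rw [Nat.cast_sub (by omega)] at this
        push_cast at this
        rw [show j + 1 + 1 = j + 2 from rfl]
        linarith

theorem exists_isOstrowski (ha : Irrational a) (h1 : 3 / 2 < a) (h2 : a < 2) {c : ℝ}
    (hc : c ∈ Set.Ico (1 - a) (2 - a)) : ∃ b, IsOstrowski a b c := by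
  choose D hD using fun j v => exists_digit ha j v
  -- `w j` is to be the remainder at j + 1; it starts at −c because the digit at β_0 is 0.
  obtain ⟨w, hw0, hw⟩ : ∃ w : ℕ → ℝ, w 0 = -c ∧
      ∀ j, w (j + 1) = D j (w j) * absDiff a (j + 1) - w j :=
    ⟨fun n => Nat.rec (-c) (fun j v => D j v * absDiff a (j + 1) - v) n, rfl, fun _ => rfl⟩
  obtain ⟨b, hb0, hb⟩ : ∃ b : ℕ → ℕ, b 0 = 0 ∧ ∀ j, b (j + 1) = D j (w j) :=
    ⟨fun n => Nat.casesOn n 0 fun j => D j (w j), rfl, fun _ => rfl⟩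
  have hflag : ∀ j, 0 ≤ (if b j = 0 then (0 : ℝ) else absDiff a (j + 1)) := fun j => by
    split_ifs
    exacts [le_rfl, (absDiff_pos ha _).le]
  have hrange : ∀ j, TailRange a j (if b j = 0 then 0 else absDiff a (j + 1)) (w j) := by
    intro j
    induction j with
    | zero =>
      rw [if_pos hb0, hw0]
      refine ⟨fun h => absurd h (by decide), fun _ => ?_⟩
      rw [zero_add, absDiff_one ha h1 h2, absDiff_zero_eq h1 h2]
      exact ⟨by linarith [hc.2], by linarith [hc.1]⟩
    | succ j ih =>
      rw [hw, hb]
      exact (hD j (w j) _ ih (hflag j)).2.2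
  have hle : ∀ k, (b k : ℤ) ≤ partialQuot a (k + 1) := by
    intro k
    cases k with
    | zero => rw [hb0, partialQuot_one h1 h2]; norm_num
    | succ k =>
      rw [hb]
      exact (hD k (w k) _ (hrange k) (hflag k)).1
  have hcarry : ∀ k, (b (k + 1) : ℤ) = partialQuot a (k + 2) → b k = 0 := by
    intro k hk
    by_contra h0
    have := (hD k (w k) _ (hrange k) (hflag k)).2.1 (if_neg h0)
    rw [← hb] at this
    omega
  have htail : ∀ j, ostrowskiTail a b c (j + 1) = w j := by
    intro j
    induction j with
    | zero => rw [hw0]; simp [ostrowskiTail, hb0]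
    | succ j ih => rw [ostrowskiTail_succ, ih, hw, hb]
  have hlim := tendsto_absDiff ha
  have hwlim : Tendsto w atTop (𝓝 0) := by
    refine squeeze_zero_norm (fun j => ?_) hlim
    have h3 := (hrange j).weak
    have h4 := hflag j
    have h5 := absDiff_succ_le ha j
    rw [Real.norm_eq_abs, abs_le]
    constructor <;> linarith
  refine ⟨b, ?_, hle, hcarry, ?_, ?_⟩
  · rw [hb0, partialQuot_one h1 h2]; norm_num
  -- If all even digits were eventually maximal, B_j − w_j would be constant along odd j. Its limit
  -- is 0, so w_j would equal B_j, an endpoint excluded for odd j.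
  · by_contra hcon
    push Not at hcon
    obtain ⟨n, hn⟩ := hcon
    have hfull : ∀ k, n ≤ k → Even k → (b k : ℤ) = partialQuot a (k + 1) := fun k hk hk' =>
      le_antisymm (hle k) (hn k hk hk')
    have hconst : ∀ m, absDiff a (2 * n + 1 + 2 * m) - w (2 * n + 1 + 2 * m) =
        absDiff a (2 * n + 1) - w (2 * n + 1) := by
      intro m
      induction m with
      | zero => rfl
      | succ m ih =>
        rw [← ih, show 2 * n + 1 + 2 * (m + 1) = 2 * n + 1 + 2 * m + 2 by ring]
        set j := 2 * n + 1 + 2 * m with hj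
        have f1 : (b (j + 1) : ℤ) = partialQuot a (j + 2) :=
          hfull (j + 1) (by omega) ⟨n + 1 + m, by omega⟩
        have f2 : b (j + 2) = 0 := hcarry (j + 2) (hfull (j + 3) (by omega) ⟨n + 2 + m, by omega⟩)
        have f1' : (b (j + 1) : ℝ) = partialQuot a (j + 2) := by exact_mod_cast f1
        have g1 := hw j
        have g2 := hw (j + 1)
        rw [← hb] at g1 g2
        rw [f1'] at g1
        rw [f2] at g2
        have g3 := absDiff_add_two ha j
        push_cast at g2
        rw [show j + 1 + 1 = j + 2 from rfl] at g2
        linarith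
    have hsub : Tendsto (fun m => 2 * n + 1 + 2 * m) atTop atTop :=
      tendsto_atTop_mono (fun m => by simp only [id]; omega) tendsto_id
    have h3 := (hlim.sub hwlim).comp hsub
    have h4 : absDiff a (2 * n + 1) - w (2 * n + 1) = 0 - 0 := by
      refine tendsto_nhds_unique (tendsto_const_nhds.congr fun m => (hconst m).symm) h3
    have h5 := ((hrange (2 * n + 1)).1 ⟨n, rfl⟩).2
    have h6 := hflag (2 * n + 1)
    linarith
  · have hs := summable_digits ha hle
    have h3 : Tendsto (fun l => c - ∑ k ∈ range l, (b k : ℝ) * convDiff a k) atTop (𝓝 0) := by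
      rw [← tendsto_add_atTop_iff_nat 1, tendsto_zero_iff_abs_tendsto_zero]
      refine ((tendsto_zero_iff_abs_tendsto_zero _).1 hwlim).congr fun l => ?_
      simp only [Function.comp_apply]
      rw [← htail, ostrowskiTail, abs_mul]
      simp
    have h4 := tendsto_nhds_unique h3 (tendsto_const_nhds.sub hs.hasSum.tendsto_sum_nat)
    rw [show c = ∑' k, (b k : ℝ) * convDiff a k by linarith]
    exact hs.hasSum

end OstrowskiNumeration

/-! ### A calculus of parameter-free definable predicates and functions. -/

section Definability

variable {a : ℝ} {α β : Type}

/-- The symbol `+` of `latticeLang`. -/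
def addSymb : latticeLang.Functions 2 := LatticeFunc.add

/-- The symbol `<` of `latticeLang`. -/
def ltSymb : latticeLang.Relations 2 := LatticeRel.lt

/-- The symbol for `ℤ` of `latticeLang`. -/
def isIntSymb : latticeLang.Relations 1 := LatticeRel.isInt

/-- The symbol for `ℤa` of `latticeLang`. -/
def isIntMulSymb : latticeLang.Relations 1 := LatticeRel.isIntMul

/-- `P` is definable without parameters in `R_a`, for predicates of families of real numbers. -/
def DefPred (a : ℝ) {α : Type} (P : (α → ℝ) → Prop) : Prop :=
  @Set.Definable ℝ ∅ latticeLang (structR a) α {v | P v}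

/-- `f` has a graph that is definable without parameters in `R_a`. -/
def DefFun (a : ℝ) {α : Type} (f : (α → ℝ) → ℝ) : Prop :=
  DefPred a (fun v : Option α → ℝ => v none = f (fun i => v (some i)))

namespace DefPred

theorem and {P Q : (α → ℝ) → Prop} (hP : DefPred a P) (hQ : DefPred a Q) :
    DefPred a (fun v => P v ∧ Q v) := by
  let := structR a
  exact Set.Definable.inter hP hQ

theorem or {P Q : (α → ℝ) → Prop} (hP : DefPred a P) (hQ : DefPred a Q) :
    DefPred a (fun v => P v ∨ Q v) := by
  let := structR a
  exact Set.Definable.union hP hQ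

theorem not {P : (α → ℝ) → Prop} (hP : DefPred a P) : DefPred a (fun v => ¬ P v) := by
  let := structR a
  exact Set.Definable.compl hP

theorem congr {P Q : (α → ℝ) → Prop} (hP : DefPred a P) (h : ∀ v, Q v ↔ P v) : DefPred a Q := by
  rwa [show Q = P from funext fun v => propext (h v)]

theorem imp {P Q : (α → ℝ) → Prop} (hP : DefPred a P) (hQ : DefPred a Q) :
    DefPred a (fun v => P v → Q v) :=
  (hP.not.or hQ).congr fun _ => imp_iff_not_or

theorem comap {P : (α → ℝ) → Prop} (hP : DefPred a P) (f : α → β) :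
    DefPred a (fun v : β → ℝ => P (fun i => v (f i))) := by
  let := structR a
  exact Set.Definable.preimage_comp f hP

theorem ex {P : (α → ℝ) → ℝ → Prop}
    (h : DefPred a (fun v : Option α → ℝ => P (fun i => v (some i)) (v none))) :
    DefPred a (fun v => ∃ x, P v x) := by
  let := structR a
  have h1 := h.comap (fun o : Option α => o.elim (Sum.inr ()) (Sum.inl : α → α ⊕ Unit))
  refine DefPred.congr (Set.Definable.exists_of_finite h1) fun v => ?_
  exact ⟨fun ⟨x, hx⟩ => ⟨fun _ => x, hx⟩, fun ⟨u, hu⟩ => ⟨u (), hu⟩⟩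

theorem all {P : (α → ℝ) → ℝ → Prop}
    (h : DefPred a (fun v : Option α → ℝ => P (fun i => v (some i)) (v none))) :
    DefPred a (fun v => ∀ x, P v x) :=
  (DefPred.ex (P := fun v x => ¬ P v x) h.not).not.congr fun v => by push Not; rfl

theorem subst {P : (α → ℝ) → ℝ → Prop} {f : (α → ℝ) → ℝ}
    (h : DefPred a (fun v : Option α → ℝ => P (fun i => v (some i)) (v none))) (hf : DefFun a f) :
    DefPred a (fun v => P v (f v)) :=
  (DefPred.ex (P := fun v x => x = f v ∧ P v x) (hf.and h)).congr fun v => by simp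

theorem subst₁ {R : ℝ → Prop} (hR : DefPred a (fun v : Fin 1 → ℝ => R (v 0)))
    {f : (α → ℝ) → ℝ} (hf : DefFun a f) : DefPred a (fun v => R (f v)) :=
  subst (P := fun _ x => R x) (hR.comap (fun _ => none)) hf

theorem lift {f : (α → ℝ) → ℝ} (hf : DefFun a f) :
    DefFun a (fun v : Option α → ℝ => f (fun i => v (some i))) :=
  DefPred.comap hf (fun o : Option α => o.elim none (fun i => some (some i)))

theorem subst₂ {R : ℝ → ℝ → Prop} (hR : DefPred a (fun v : Fin 2 → ℝ => R (v 0) (v 1)))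
    {f g : (α → ℝ) → ℝ} (hf : DefFun a f) (hg : DefFun a g) :
    DefPred a (fun v => R (f v) (g v)) :=
  subst (P := fun v x => R x (g v))
    (subst (P := fun v y => R (v none) y)
      (hR.comap (fun i : Fin 2 => if i = 0 then some none else none)) (lift hg)) hf

theorem lt_aux : DefPred a (fun v : Fin 2 → ℝ => v 0 < v 1) := by
  let := structR a
  refine Set.empty_definable_iff.2 ⟨FirstOrder.Language.Relations.formula₂
    ltSymb (FirstOrder.Language.Term.var 0)
      (FirstOrder.Language.Term.var 1), ?_⟩
  ext v
  rw [Set.mem_ofPred_eq, Set.mem_ofPred_eq, FirstOrder.Language.Formula.realize_rel₂]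
  rfl

theorem isInt_aux : DefPred a (fun v : Fin 1 → ℝ => ∃ n : ℤ, v 0 = n) := by
  let := structR a
  refine Set.empty_definable_iff.2 ⟨FirstOrder.Language.Relations.formula₁
    isIntSymb (FirstOrder.Language.Term.var 0), ?_⟩
  ext v
  rw [Set.mem_ofPred_eq, Set.mem_ofPred_eq, FirstOrder.Language.Formula.realize_rel₁]
  rfl

theorem isIntMul_aux : DefPred a (fun v : Fin 1 → ℝ => ∃ n : ℤ, v 0 = n * a) := by
  let := structR a
  refine Set.empty_definable_iff.2 ⟨FirstOrder.Language.Relations.formula₁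
    isIntMulSymb (FirstOrder.Language.Term.var 0), ?_⟩
  ext v
  rw [Set.mem_ofPred_eq, Set.mem_ofPred_eq, FirstOrder.Language.Formula.realize_rel₁]
  rfl

theorem eq_aux (i j : α) : DefPred a (fun v : α → ℝ => v i = v j) := by
  let := structR a
  refine Set.empty_definable_iff.2 ⟨FirstOrder.Language.Term.equal
    (FirstOrder.Language.Term.var i) (FirstOrder.Language.Term.var j), ?_⟩
  ext v
  simp

theorem add_aux : DefPred a (fun v : Fin 3 → ℝ => v 2 = v 0 + v 1) := by
  let := structR a
  refine Set.empty_definable_iff.2 ⟨FirstOrder.Language.Term.equal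
    (FirstOrder.Language.Term.var 2) (FirstOrder.Language.Functions.apply₂
      addSymb (FirstOrder.Language.Term.var 0)
      (FirstOrder.Language.Term.var 1)), ?_⟩
  ext v
  refine Iff.trans ?_ FirstOrder.Language.Formula.realize_equal.symm
  rw [FirstOrder.Language.Term.realize_functions_apply₂]
  rfl

end DefPred

theorem defFun_var (i : α) : DefFun a (fun v => v i) := DefPred.eq_aux none (some i)

theorem DefFun.add {f g : (α → ℝ) → ℝ} (hf : DefFun a f) (hg : DefFun a g) :
    DefFun a (fun v => f v + g v) := by
  refine DefPred.subst (P := fun v x => v none = x + g (fun i => v (some i))) ?_ (DefPred.lift hf)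
  refine DefPred.subst (P := fun v y => v (some none) = v none + y) ?_ (DefPred.lift (DefPred.lift hg))
  exact DefPred.add_aux.comap ![some none, none, some (some none)]

theorem DefPred.lt {f g : (α → ℝ) → ℝ} (hf : DefFun a f) (hg : DefFun a g) :
    DefPred a (fun v => f v < g v) := DefPred.lt_aux.subst₂ hf hg

theorem DefPred.le {f g : (α → ℝ) → ℝ} (hf : DefFun a f) (hg : DefFun a g) :
    DefPred a (fun v => f v ≤ g v) := (DefPred.lt hg hf).not.congr fun _ => not_lt.symm

theorem DefPred.eq {f g : (α → ℝ) → ℝ} (hf : DefFun a f) (hg : DefFun a g) :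
    DefPred a (fun v => f v = g v) := (DefPred.eq_aux 0 1).subst₂ hf hg

theorem DefPred.isInt {f : (α → ℝ) → ℝ} (hf : DefFun a f) :
    DefPred a (fun v => ∃ n : ℤ, f v = n) := 
  DefPred.subst₁ (R := fun x => ∃ n : ℤ, x = n) DefPred.isInt_aux hf

theorem DefPred.isIntMul {f : (α → ℝ) → ℝ} (hf : DefFun a f) :
    DefPred a (fun v => ∃ n : ℤ, f v = n * a) := 
  DefPred.subst₁ (R := fun x => ∃ n : ℤ, x = n * a) DefPred.isIntMul_aux hf

theorem DefFun.sub {f g : (α → ℝ) → ℝ} (hf : DefFun a f) (hg : DefFun a g) :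
    DefFun a (fun v => f v - g v) :=
  (DefPred.eq ((defFun_var none).add (DefPred.lift hg)) (DefPred.lift hf)).congr fun _ =>
    eq_sub_iff_add_eq

theorem DefFun.zero : DefFun a (fun _ : α → ℝ => 0) :=
  (DefPred.eq ((defFun_var none).add (defFun_var none)) (defFun_var none)).congr fun _ => by simp

theorem DefFun.neg {f : (α → ℝ) → ℝ} (hf : DefFun a f) : DefFun a (fun v => -f v) := by
  simpa using DefFun.zero.sub hf

theorem DefFun.abs {f : (α → ℝ) → ℝ} (hf : DefFun a f) : DefFun a (fun v => |f v|) := by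
  refine ((DefPred.le .zero (defFun_var none)).and ((DefPred.eq (defFun_var none) (DefPred.lift hf)).or
    (DefPred.eq (defFun_var none) (DefPred.lift hf).neg))).congr fun v => ?_
  constructor
  · intro h
    rw [h]
    exact ⟨abs_nonneg _, abs_choice _⟩
  · rintro ⟨h0, h | h⟩
    · rw [h] at h0 ⊢
      exact (abs_of_nonneg h0).symm
    · rw [h] at h0 ⊢
      exact (abs_of_nonpos (neg_nonneg.1 h0)).symm

theorem DefFun.nsmul {f : (α → ℝ) → ℝ} (hf : DefFun a f) (n : ℕ) :
    DefFun a (fun v => n * f v) := by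
  induction n with
  | zero => simpa using DefFun.zero
  | succ n ih => simpa [add_mul] using ih.add hf

theorem DefFun.zsmul {f : (α → ℝ) → ℝ} (hf : DefFun a f) (n : ℤ) :
    DefFun a (fun v => n * f v) := by
  obtain ⟨m, rfl | rfl⟩ := n.eq_nat_or_neg
  · exact_mod_cast hf.nsmul m
  · simpa using (hf.nsmul m).neg

/-- The language has no constants: 1 is recovered as the least positive element of ℤ, and a > 0
below as that of ℤa. -/
theorem DefFun.one : DefFun a (fun _ : α → ℝ => 1) := by
  refine (((DefPred.lt .zero (defFun_var none)).and (DefPred.isInt (defFun_var none))).and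
    (DefPred.all (P := fun v x => (0 < x ∧ ∃ n : ℤ, x = n) → v none ≤ x)
      (((DefPred.lt .zero (defFun_var none)).and (DefPred.isInt (defFun_var none))).imp
        (DefPred.le (defFun_var _) (defFun_var _))))).congr fun v => ?_
  constructor
  · rintro h
    rw [h]
    refine ⟨⟨one_pos, 1, by simp⟩, ?_⟩
    rintro _ ⟨h0, n, rfl⟩
    have : 1 ≤ n := by exact_mod_cast h0
    change (1 : ℝ) ≤ n
    exact_mod_cast this
  · rintro ⟨⟨h0, n, hn⟩, h1⟩
    refine le_antisymm (h1 1 ⟨one_pos, 1, by simp⟩) ?_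
    rw [hn] at h0 ⊢
    have : 1 ≤ n := by exact_mod_cast h0
    change (1 : ℝ) ≤ n
    exact_mod_cast this

theorem DefFun.self (ha : 0 < a) : DefFun a (fun _ : α → ℝ => a) := by
  refine (((DefPred.lt .zero (defFun_var none)).and (DefPred.isIntMul (defFun_var none))).and
    (DefPred.all (P := fun v x => (0 < x ∧ ∃ n : ℤ, x = n * a) → v none ≤ x)
      (((DefPred.lt .zero (defFun_var none)).and (DefPred.isIntMul (defFun_var none))).imp
        (DefPred.le (defFun_var _) (defFun_var _))))).congr fun v => ?_
  have key : ∀ n : ℤ, 0 < n * a → a ≤ n * a := fun n hn => by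
    have h1 : (0 : ℝ) < n := pos_of_mul_pos_left hn ha.le
    have h2 : (1 : ℝ) ≤ n := by
      have : 0 < n := by exact_mod_cast h1
      exact_mod_cast this
    nlinarith
  constructor
  · rintro h
    rw [h]
    refine ⟨⟨ha, 1, by simp⟩, ?_⟩
    rintro _ ⟨h0, n, rfl⟩
    exact key n h0
  · rintro ⟨⟨h0, n, hn⟩, h1⟩
    refine le_antisymm (h1 a ⟨ha, 1, by simp⟩) ?_
    rw [hn] at h0 ⊢
    exact key n h0

theorem DefPred.mem₁ {S : Set ℝ} (hS : DefinableInR₁ a S) {f : (α → ℝ) → ℝ} (hf : DefFun a f) :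
    DefPred a (fun v => f v ∈ S) := DefPred.subst₁ (R := fun x => x ∈ S) hS hf

theorem DefPred.mem₂ {S : Set (ℝ × ℝ)} (hS : DefinableInR₂ a S) {f g : (α → ℝ) → ℝ}
    (hf : DefFun a f) (hg : DefFun a g) : DefPred a (fun v => (f v, g v) ∈ S) :=
  DefPred.subst₂ (R := fun x y => (x, y) ∈ S) hS hf hg

theorem definableInR₁_iff {S : Set ℝ} :
    DefinableInR₁ a S ↔ DefPred a (fun v : Fin 1 → ℝ => v 0 ∈ S) := Iff.rfl

theorem definableInR₂_iff {S : Set (ℝ × ℝ)} :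
    DefinableInR₂ a S ↔ DefPred a (fun v : Fin 2 → ℝ => (v 0, v 1) ∈ S) := Iff.rfl

end Definability

/-! ### Transfer of definability between rationally related a and a'. -/

section Scaling

open FirstOrder FirstOrder.Language

variable {a a' : ℝ} {α β : Type} {m : ℕ} {n : ℤ}

theorem defFun_realize_scaled (hm : m ≠ 0) (t : latticeLang.Term β) :
    DefFun a (fun v : β → ℝ =>
      m * @Term.realize latticeLang ℝ (structR a') β (fun i => v i / m) t) := by
  let := structR a'
  have hm' : (m : ℝ) ≠ 0 := by exact_mod_cast hm
  induction t with
  | var i =>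
    simp only [Term.realize_var, mul_div_cancel₀ _ hm']
    exact defFun_var i
  | func f ts ih =>
    cases f with
    | add =>
      have h := (ih 0).add (ih 1)
      simp only [← mul_add] at h
      exact h

/-- Multiplication by m > 0 preserves order and addition, and carries ℤ to mℤ and ℤa' to n ℤa; both
images are definable over a. Quantifiers transfer because division by m is onto. -/
theorem defPred_realize_scaled (hm : m ≠ 0) (h : (m : ℝ) * a' = n * a) {k : ℕ}
    (φ : latticeLang.BoundedFormula α k) :
    DefPred a (fun v : α ⊕ Fin k → ℝ => @BoundedFormula.Realize latticeLang ℝ (structR a') α k φ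
      (fun i => v (Sum.inl i) / m) (fun i => v (Sum.inr i) / m)) := by
  let := structR a'
  have hm' : (0 : ℝ) < m := by exact_mod_cast Nat.pos_of_ne_zero hm
  have hterm : ∀ {k : ℕ} (t : latticeLang.Term (α ⊕ Fin k)), DefFun a (fun v : α ⊕ Fin k → ℝ =>
      m * t.realize (Sum.elim (fun i => v (Sum.inl i) / m) (fun i => v (Sum.inr i) / m))) := by
    intro k t
    have e : ∀ v : α ⊕ Fin k → ℝ, Sum.elim (fun i => v (Sum.inl i) / m)
        (fun i => v (Sum.inr i) / m) = fun i => v i / m := fun v => by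
      funext i; cases i <;> rfl
    simp only [e]
    exact defFun_realize_scaled hm t
  induction φ with
  | falsum => exact (DefPred.lt .zero .zero).congr fun v => (iff_of_false id (lt_irrefl _))
  | equal t₁ t₂ =>
    exact (DefPred.eq (hterm t₁) (hterm t₂)).congr fun v => (mul_right_inj' hm'.ne').symm
  | rel R ts =>
    cases R with
    | lt =>
      exact (DefPred.lt (hterm (ts 0)) (hterm (ts 1))).congr fun v =>
        (mul_lt_mul_iff_right₀ hm').symm
    | isInt =>
      refine (DefPred.ex (P := fun v w => (∃ z : ℤ, w = z) ∧
        m * (ts 0).realize (Sum.elim (fun i => v (Sum.inl i) / m) (fun i => v (Sum.inr i) / m)) =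
          m * w) ((DefPred.isInt (defFun_var _)).and (DefPred.eq (DefPred.lift (hterm (ts 0)))
            ((defFun_var none).nsmul m)))).congr fun v => ?_
      change (∃ z : ℤ, _ = (z : ℝ)) ↔ _
      simp only [mul_right_inj' hm'.ne']
      exact ⟨fun ⟨z, hz⟩ => ⟨_, ⟨z, rfl⟩, hz⟩, fun ⟨_, ⟨z, rfl⟩, hz⟩ => ⟨z, hz⟩⟩
    | isIntMul =>
      refine (DefPred.ex (P := fun v w => (∃ z : ℤ, w = z * a) ∧
        m * (ts 0).realize (Sum.elim (fun i => v (Sum.inl i) / m) (fun i => v (Sum.inr i) / m)) =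
          n * w) ((DefPred.isIntMul (defFun_var _)).and (DefPred.eq (DefPred.lift (hterm (ts 0)))
            ((defFun_var none).zsmul n)))).congr fun v => ?_
      change (∃ z : ℤ, _ = (z : ℝ) * a') ↔ _
      have e : ∀ (x : ℝ) (z : ℤ), x = z * a' ↔ m * x = n * (z * a) := fun x z => by
        rw [← mul_right_inj' hm'.ne', show (m : ℝ) * (z * a') = n * (z * a) by
          linear_combination (z : ℝ) * h]
      simp only [e]
      exact ⟨fun ⟨z, hz⟩ => ⟨_, ⟨z, rfl⟩, hz⟩, fun ⟨_, ⟨z, rfl⟩, hz⟩ => ⟨z, hz⟩⟩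
  | imp _ _ ih₁ ih₂ => exact ih₁.imp ih₂
  | @all k φ ih =>
    have h1 := ih.comap (β := Option (α ⊕ Fin k)) (Sum.elim (fun i => some (Sum.inl i))
      (Fin.snoc (α := fun _ => Option (α ⊕ Fin k)) (fun i => some (Sum.inr i)) none))
    refine (DefPred.all (P := fun v y => φ.Realize (fun i => v (Sum.inl i) / m)
      (Fin.snoc (α := fun _ => ℝ) (fun i => v (Sum.inr i) / m) (y / m)))
      (h1.congr fun v => ?_)).congr fun v => ?_
    · have e : (Fin.snoc (α := fun _ => ℝ) (fun i => v (some (Sum.inr i)) / m) (v none / m) :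
          Fin (k + 1) → ℝ) = fun i => v (Sum.elim (fun i => some (Sum.inl i))
            (Fin.snoc (α := fun _ => Option (α ⊕ Fin k)) (fun i => some (Sum.inr i)) none)
              (Sum.inr i : α ⊕ Fin (k + 1))) / m := by
        funext i
        refine Fin.lastCases ?_ (fun i => ?_) i <;> simp
      rw [e]
      rfl
    · exact ⟨fun hx y => hx _, fun hx y => by
        have := hx (m * y)
        rwa [mul_div_cancel_left₀ _ hm'.ne'] at this⟩

theorem DefPred.scale (hm : m ≠ 0) (h : (m : ℝ) * a' = n * a) {P : (α → ℝ) → Prop}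
    (hP : DefPred a' P) : DefPred a (fun v => P (fun i => v i / m)) := by
  let := structR a'
  obtain ⟨φ, hφ⟩ := Set.empty_definable_iff.1 hP
  have h1 := (defPred_realize_scaled hm h φ).comap (Sum.elim id Fin.elim0 : α ⊕ Fin 0 → α)
  refine h1.congr fun v => ?_
  have h2 : P (fun i => v i / m) ↔ φ.Realize (fun i => v i / m) := Set.ext_iff.1 hφ _
  rw [h2, Formula.Realize]
  refine iff_of_eq (congrArg _ (Subsingleton.elim _ _))

/-- The numbers m and n are the denominator and numerator of a rational r with 3/2 < r a < 2; a
negative a is handled by a negative r. -/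
theorem exists_scale {a : ℝ} (ha : Irrational a) : ∃ (m : ℕ) (n : ℤ) (a' : ℝ), m ≠ 0 ∧
    (m : ℝ) * a' = n * a ∧ Irrational a' ∧ 3 / 2 < a' ∧ a' < 2 := by
  obtain ⟨r, h1, h2⟩ : ∃ r : ℚ, 3 / 2 < r * a ∧ r * a < 2 := by
    rcases lt_or_gt_of_ne ha.ne_zero with h0 | h0
    · obtain ⟨r, h1, h2⟩ := exists_rat_btwn (show 2 / a < 3 / 2 / a by
        rw [div_lt_div_right_of_neg h0]; norm_num)
      exact ⟨r, (lt_div_iff_of_neg h0).1 h2, (div_lt_iff_of_neg h0).1 h1⟩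
    · obtain ⟨r, h1, h2⟩ := exists_rat_btwn (show 3 / 2 / a < 2 / a by
        rw [div_lt_div_iff_of_pos_right h0]; norm_num)
      exact ⟨r, (div_lt_iff₀ h0).1 h1, (lt_div_iff₀ h0).1 h2⟩
  have hr : r ≠ 0 := by
    rintro rfl
    norm_num at h1
  refine ⟨r.den, r.num, r * a, r.den_nz, ?_, ha.ratCast_mul hr, h1, h2⟩
  have : (r.den : ℝ) * r = r.num := by exact_mod_cast r.den_mul_eq_num
  rw [← mul_assoc, this]

end Scaling

/-! ### Definability of digits, and the Büchi structure for 3/2 < a < 2. -/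

section Digits

variable {a : ℝ} (ha : Irrational a) (h1 : 3 / 2 < a) (h2 : a < 2)
include ha h1 h2

omit ha h2 in
theorem definable_bestApprox : DefinableInR₂ a (bestApprox a) := by
  have ha0 : 0 < a := by linarith
  rw [definableInR₂_iff]
  have key : DefPred a (fun v : Fin 2 → ℝ => ((0 ≤ v 0 ∧ ∃ n : ℤ, v 0 = n) ∧
      (0 < v 1 ∧ ∃ n : ℤ, v 1 = n * a)) ∧ ∀ x y : ℝ, (0 ≤ x ∧ ∃ n : ℤ, x = n) →
        (0 < y ∧ ∃ n : ℤ, y = n * a) → y ≤ v 1 → ¬ (v 0 = x ∧ v 1 = y) →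
          |v 1 - v 0| < |y - x|) := by
    -- Syntax-directed: each rule removes the outermost connective or operation of the formula.
    repeat' first
      | with_reducible exact defFun_var _
      | with_reducible exact DefFun.zero
      | with_reducible apply DefPred.and
      | with_reducible apply DefPred.isInt
      | with_reducible apply DefPred.isIntMul
      | with_reducible apply DefPred.lt
      | with_reducible apply DefPred.le
      | with_reducible apply DefPred.eq
      | with_reducible apply DefPred.not
      | with_reducible apply DefPred.all
      | with_reducible apply DefPred.imp
      | with_reducible apply DefFun.abs
      | with_reducible apply DefFun.sub
  refine key.congr fun v => ?_
  have hnat : ∀ x : ℝ, (0 ≤ x ∧ ∃ n : ℤ, x = n) ↔ ∃ p : ℕ, x = p := by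
    intro x
    constructor
    · rintro ⟨h0, n, rfl⟩
      obtain ⟨p, rfl⟩ := Int.eq_ofNat_of_zero_le (show 0 ≤ n by exact_mod_cast h0)
      exact ⟨p, by simp⟩
    · rintro ⟨p, rfl⟩
      exact ⟨p.cast_nonneg, p, by simp⟩
  have hmul : ∀ y : ℝ, (0 < y ∧ ∃ n : ℤ, y = n * a) ↔ ∃ q : ℕ, 1 ≤ q ∧ y = q * a := by
    intro y
    constructor
    · rintro ⟨h0, n, rfl⟩
      have h3 : 0 < n := by
        have := pos_of_mul_pos_left h0 ha0.le
        exact_mod_cast this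
      obtain ⟨q, rfl⟩ := Int.eq_ofNat_of_zero_le h3.le
      exact ⟨q, by omega, by simp⟩
    · rintro ⟨q, hq, rfl⟩
      have : (0 : ℝ) < q := by exact_mod_cast hq
      exact ⟨by positivity, q, by simp⟩
  simp only [hnat, hmul]
  constructor
  · rintro ⟨p, q, hq, hz, hb⟩
    simp only [Prod.mk.injEq] at hz
    rw [hz.1, hz.2]
    refine ⟨⟨⟨p, rfl⟩, q, hq, rfl⟩, ?_⟩
    rintro _ _ ⟨p', rfl⟩ ⟨q', hq', rfl⟩ hle hne
    refine hb p' q' hq' ?_ ?_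
    · exact_mod_cast le_of_mul_le_mul_right hle ha0
    · rintro h
      simp only [Prod.mk.injEq] at h
      exact hne ⟨by rw [h.1], by rw [h.2]⟩
  · rintro ⟨⟨⟨p, hp⟩, q, hq, hq2⟩, hb⟩
    rw [hp, hq2] at hb ⊢
    refine ⟨p, q, hq, rfl, fun p' q' hq' hle hne => hb _ _ ⟨p', rfl⟩ ⟨q', hq', rfl⟩ ?_ ?_⟩
    · have : (q' : ℝ) ≤ q := by exact_mod_cast hle
      exact mul_le_mul_of_nonneg_right this ha0.le
    · rintro ⟨e1, e2⟩
      apply hne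
      rw [Nat.cast_inj.1 e1, Nat.cast_inj.1 (mul_right_cancel₀ ha0.ne' e2)]

omit ha h2 in
theorem definable_bestDen : DefinableInR₁ a (bestDen a) := by
  rw [definableInR₁_iff]
  refine (DefPred.ex (P := fun v p => (p, v 0) ∈ bestApprox a)
    (DefPred.mem₂ (definable_bestApprox h1) (defFun_var _) (defFun_var _))).congr fun v => ?_
  simp [bestDen]

omit ha h2 in
theorem definable_Ico : DefPred a (fun v : Fin 1 → ℝ => v 0 ∈ Set.Ico (1 - a) (2 - a)) := by
  have hself : ∀ {α : Type}, DefFun a (fun _ : α → ℝ => a) := DefFun.self (by linarith)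
  refine ((DefPred.le (DefFun.one.sub hself) (defFun_var 0)).and (DefPred.lt (defFun_var 0)
    ((DefFun.one.add DefFun.one).sub hself))).congr fun v => ?_
  norm_num

/-- Odd indices are those with β_l < 0, so parity becomes an order comparison. -/
theorem mem_oddDen_iff (x : ℝ) : x ∈ oddDen a ↔ ∃ p, (p, x) ∈ bestApprox a ∧ x < p := by
  simp only [mem_bestApprox_iff ha h1 h2, Prod.mk.injEq]
  constructor
  · rintro ⟨l, hl, rfl⟩
    refine ⟨convNum a l, ⟨l, hl.pos, rfl, rfl⟩, ?_⟩
    have h3 := absDiff_pos ha l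
    rw [absDiff, hl.neg_one_pow, convDiff] at h3
    linarith
  · rintro ⟨_, ⟨l, hl, rfl, rfl⟩, hlt⟩
    refine ⟨l, ?_, rfl⟩
    by_contra hodd
    have h3 := absDiff_pos ha l
    rw [absDiff, (Nat.not_odd_iff_even.1 hodd).neg_one_pow, convDiff] at h3
    linarith

theorem definable_oddDen : DefinableInR₁ a (oddDen a) := by
  rw [definableInR₁_iff]
  exact (DefPred.ex (P := fun v p => (p, v 0) ∈ bestApprox a ∧ v 0 < p)
    ((DefPred.mem₂ (definable_bestApprox h1) (defFun_var _) (defFun_var _)).and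
      (DefPred.lt (defFun_var _) (defFun_var _)))).congr fun v => mem_oddDen_iff ha h1 h2 _

omit h1 h2 in
theorem convDen_mul_lt_iff (ha0 : 0 < a) {k l : ℕ} (hk : 1 ≤ k) (hl : 1 ≤ l) :
    (convDen a k : ℝ) * a < convDen a l * a ↔ k < l := by
  rw [mul_lt_mul_iff_left₀ ha0, Nat.cast_lt, convDen_lt_iff ha hk hl]

omit h1 h2 in
theorem convDen_mul_inj (ha0 : 0 < a) {k l : ℕ} (hk : 1 ≤ k) (hl : 1 ≤ l)
    (h : (convDen a k : ℝ) * a = convDen a l * a) : k = l :=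
  convDen_inj ha hk hl (by exact_mod_cast mul_right_cancel₀ ha0.ne' h)

theorem IsOstrowski.mem_digitRel_iff {b : ℕ → ℕ} {c : ℝ} (h : IsOstrowski a b c) {l : ℕ}
    (hl : 1 ≤ l) (i : ℕ) : ((convDen a l : ℝ) * a, c) ∈ digitRel a i ↔ b l = i := by
  constructor
  · rintro ⟨_, l', b', hl', he, hb', rfl⟩
    rw [convDen_mul_inj ha (by linarith) hl hl' he, h.unique ha hb']
  · exact fun hi => ⟨h.mem_Ico ha h1 h2, l, b, hl, rfl, h, hi⟩

/-- The remainder condition, expressed through `(p_l, q_l a)` and `(p_{l+1}, q_{l+1} a)`. -/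
def tailCondition (p x p' x' y t : ℝ) : Prop :=
  (x < p ∧ -(x' - p') ≤ t ∧ (y < x → t < -(x - p)) ∧ (x ≤ y → t < -(x - p) - (x' - p'))) ∨
  (p < x ∧ x' - p' < -t ∧ (y < x → -t ≤ x - p) ∧ (x ≤ y → -t ≤ (x - p) + (x' - p')))

-- The sign of q_l a − p_l replaces the powers of −1, and comparing n a with q_l a replaces the case
-- distinction on n.
omit h2 in
theorem tailCondition_iff (l : ℕ) (n : ℤ) (t : ℝ) :
    tailCondition (convNum a l) (convDen a l * a) (convNum a (l + 1)) (convDen a (l + 1) * a)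
      (n * a) t ↔
    TailRange a l (if n < convDen a l then 0 else absDiff a (l + 1)) ((-1) ^ (l + 1) * t) := by
  have ha0 : 0 < a := by linarith
  have hB := absDiff_pos ha l
  have hlt : (n : ℝ) * a < convDen a l * a ↔ n < convDen a l := by
    rw [mul_lt_mul_iff_left₀ ha0]; exact_mod_cast Iff.rfl
  have hle : (convDen a l : ℝ) * a ≤ n * a ↔ ¬ n < convDen a l := by rw [← not_lt, hlt]
  have e1 : (convDen a l : ℝ) * a - convNum a l = (-1) ^ l * absDiff a l := by
    rw [← convDiff_eq, convDiff]
  have e2 : (convDen a (l + 1) : ℝ) * a - convNum a (l + 1) =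
      (-1) ^ (l + 1) * absDiff a (l + 1) := by
    rw [← convDiff_eq, convDiff]
  rw [tailCondition, hlt, hle, ← sub_neg, ← sub_pos (b := (convNum a l : ℝ)), e1, e2]
  rcases Nat.even_or_odd l with hl | hl
  · have hl' : ¬ Odd l := Nat.not_odd_iff_even.2 hl
    rw [hl.neg_one_pow, hl.add_one.neg_one_pow]
    simp only [TailRange, hl, hl', false_implies, true_and, true_implies, one_mul, neg_one_mul,
      hB, hB.le.not_gt, false_and, false_or]
    split_ifs with hn <;> simp [hn, sub_eq_add_neg]
  · have hl' : ¬ Even l := Nat.not_even_iff_odd.2 hl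
    rw [hl.neg_one_pow, hl.add_one.neg_one_pow]
    have hB' : -absDiff a l < 0 := by linarith
    simp only [TailRange, hl, hl', false_implies, and_true, true_implies, one_mul, neg_one_mul,
      hB', hB'.le.not_gt, false_and, or_false, true_and, neg_neg]
    split_ifs with hn <;> simp [hn]

/-- Here (p, x) and (p', x') are the convergents l and l + 1, adjacency being tested inside
`bestDen`. By `IsOstrowski.eq_trunc`, the tail condition together with 0 ≤ y < x' forces y to be a
times the truncation up to l, and the bounds i x ≤ y < (i + 1) x then read off the digit. -/
theorem mem_digitRel_iff_exists (i : ℕ) (x c : ℝ) : (x, c) ∈ digitRel a i ↔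
    c ∈ Set.Ico (1 - a) (2 - a) ∧ ∃ p p' x' y z : ℝ, ((p, x) ∈ bestApprox a ∧
      (p', x') ∈ bestApprox a) ∧ (x < x' ∧ ∀ w, w ∈ bestDen a → ¬ (x < w ∧ w < x')) ∧
      ((∃ n : ℤ, y = n * a) ∧ ∃ n : ℤ, z = n) ∧ (0 ≤ y ∧ y < x') ∧
      (i * x ≤ y ∧ y < i * x + x) ∧ tailCondition p x p' x' y (c - (y - z)) := by
  have ha0 : 0 < a := by linarith
  simp only [mem_bestApprox_iff ha h1 h2, Prod.mk.injEq]
  refine and_congr_right fun hc => ?_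
  constructor
  · rintro ⟨l, b, hl, hx, hb, hi⟩
    obtain ⟨P, hP⟩ := hb.exists_tailRange ha l
    rw [← tailCondition_iff ha h1] at hP
    obtain ⟨d1, d2⟩ := (hb.digit_iff ha l i).1 hi
    have d3 := hb.trunc_lt ha (l + 1)
    simp only at hx
    subst hx
    refine ⟨_, _, _, _, _, ⟨⟨l, hl, rfl, rfl⟩, ⟨l + 1, by omega, rfl, rfl⟩⟩, ⟨?_, ?_⟩,
      ⟨⟨ostrowskiTrunc a b (l + 1), rfl⟩, ⟨P, rfl⟩⟩, ⟨?_, ?_⟩, ⟨?_, ?_⟩, hP⟩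
    · exact (convDen_mul_lt_iff ha ha0 hl (by omega)).2 (by omega)
    · rw [bestDen_eq ha h1 h2]
      rintro _ ⟨k, hk, rfl⟩ ⟨g1, g2⟩
      rw [convDen_mul_lt_iff ha ha0 hl hk] at g1
      rw [convDen_mul_lt_iff ha ha0 hk (by omega)] at g2
      omega
    · positivity
    · refine mul_lt_mul_of_pos_right ?_ ha0
      exact_mod_cast d3
    · rw [← mul_assoc]
      refine mul_le_mul_of_nonneg_right ?_ ha0.le
      exact_mod_cast d1
    · rw [show (i : ℝ) * (convDen a l * a) + convDen a l * a = ((i + 1) * convDen a l) * a by ring]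
      refine mul_lt_mul_of_pos_right ?_ ha0
      exact_mod_cast d2
  · rintro ⟨_, _, _, _, _, ⟨⟨l, hl, rfl, rfl⟩, ⟨l', hl', rfl, rfl⟩⟩, ⟨g1, g2⟩,
      ⟨⟨n, rfl⟩, ⟨P, rfl⟩⟩, ⟨g3, g4⟩, ⟨g5, g6⟩, ht⟩
    obtain rfl : l' = l + 1 := by
      rw [convDen_mul_lt_iff ha ha0 hl hl'] at g1
      by_contra hne
      refine g2 (convDen a (l + 1) * a) ?_
        ⟨(convDen_mul_lt_iff ha ha0 hl (by omega)).2 (by omega),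
          (convDen_mul_lt_iff ha ha0 (by omega) hl').2 (by omega)⟩
      rw [bestDen_eq ha h1 h2]
      exact ⟨l + 1, by omega, rfl⟩
    obtain ⟨b, hb⟩ := exists_isOstrowski ha h1 h2 hc
    refine ⟨l, b, hl, rfl, hb, ?_⟩
    rw [tailCondition_iff ha h1] at ht
    have g3' : 0 ≤ n := by exact_mod_cast nonneg_of_mul_nonneg_left g3 ha0
    have g4' : n < convDen a (l + 1) := by exact_mod_cast lt_of_mul_lt_mul_right g4 ha0.le
    have hn := hb.eq_trunc ha l g3' g4' ht
    rw [hb.digit_iff ha]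
    rw [hn, ← mul_assoc] at g5
    rw [hn, show (i : ℝ) * (convDen a l * a) + convDen a l * a = ((i + 1) * convDen a l) * a by
      ring] at g6
    have g5' := le_of_mul_le_mul_right g5 ha0
    have g6' := lt_of_mul_lt_mul_right g6 ha0.le
    exact ⟨by exact_mod_cast g5', by exact_mod_cast g6'⟩

theorem definable_digitRel (i : ℕ) : DefinableInR₂ a (digitRel a i) := by
  rw [definableInR₂_iff]
  refine DefPred.congr ?_ fun v => mem_digitRel_iff_exists ha h1 h2 i (v 0) (v 1)
  refine DefPred.and (DefPred.subst₁ (R := fun x => x ∈ Set.Ico (1 - a) (2 - a))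
    (definable_Ico h1) (defFun_var _)) ?_
  unfold tailCondition
  repeat' first
    | with_reducible exact defFun_var _
    | with_reducible exact DefFun.zero
    | with_reducible apply DefPred.mem₂ (definable_bestApprox h1)
    | with_reducible apply DefPred.mem₁ (definable_bestDen h1)
    | with_reducible apply DefPred.and
    | with_reducible apply DefPred.or
    | with_reducible apply DefPred.isInt
    | with_reducible apply DefPred.isIntMul
    | with_reducible apply DefPred.lt
    | with_reducible apply DefPred.le
    | with_reducible apply DefPred.not
    | with_reducible apply DefPred.ex
    | with_reducible apply DefPred.all
    | with_reducible apply DefPred.imp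
    | with_reducible apply DefFun.sub
    | with_reducible apply DefFun.neg
    | with_reducible apply DefFun.add
    | with_reducible apply DefFun.nsmul

/-- Existence and uniqueness of the expansion trade the quantifier over digit sequences for one over
positions q_l a. -/
theorem mem_oddDigitSet_iff (c : ℝ) : c ∈ oddDigitSet a ↔ c ∈ Set.Ico (1 - a) (2 - a) ∧
    ∀ x, x ∈ bestDen a → ((x, c) ∈ digitRel a 0 ∨ (x, c) ∈ digitRel a 1) ∧
      (¬ x ∈ oddDen a → (x, c) ∈ digitRel a 0) := by
  have ha0 : 0 < a := by linarith
  refine and_congr_right fun hc => ?_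
  rw [bestDen_eq ha h1 h2]
  have hodd : ∀ l, 1 ≤ l → ((convDen a l : ℝ) * a ∉ oddDen a ↔ Even l) := by
    intro l hl
    rw [← Nat.not_odd_iff_even, not_iff_not]
    constructor
    · rintro ⟨k, hk, e⟩
      rwa [convDen_mul_inj ha ha0 hl hk.pos e]
    · exact fun h => ⟨l, h, rfl⟩
  constructor
  · rintro ⟨b, hb, h3⟩ _ ⟨l, hl, rfl⟩
    rw [hb.mem_digitRel_iff ha h1 h2 hl, hb.mem_digitRel_iff ha h1 h2 hl, hodd l hl]
    exact h3 l hl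
  · intro h3
    obtain ⟨b, hb⟩ := exists_isOstrowski ha h1 h2 hc
    refine ⟨b, hb, fun l hl => ?_⟩
    have := h3 _ ⟨l, hl, rfl⟩
    rwa [hb.mem_digitRel_iff ha h1 h2 hl, hb.mem_digitRel_iff ha h1 h2 hl, hodd l hl] at this

theorem definable_oddDigitSet : DefinableInR₁ a (oddDigitSet a) := by
  rw [definableInR₁_iff]
  refine DefPred.congr ?_ fun v => mem_oddDigitSet_iff ha h1 h2 (v 0)
  refine (definable_Ico h1).and ?_
  repeat' first
    | with_reducible exact defFun_var _
    | with_reducible apply DefPred.mem₂ (definable_digitRel ha h1 h2 0)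
    | with_reducible apply DefPred.mem₂ (definable_digitRel ha h1 h2 1)
    | with_reducible apply DefPred.mem₁ (definable_bestDen h1)
    | with_reducible apply DefPred.mem₁ (definable_oddDen ha h1 h2)
    | with_reducible apply DefPred.and
    | with_reducible apply DefPred.or
    | with_reducible apply DefPred.not
    | with_reducible apply DefPred.all
    | with_reducible apply DefPred.imp

theorem exists_oddDen_equiv : ∃ e : ℕ ≃ oddDen a,
    (∀ k, (e k : ℝ) = convDen a (2 * k + 1) * a) ∧ ∀ k l, (e k : ℝ) < e l ↔ k < l := by
  have ha0 : 0 < a := by linarith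
  refine ⟨Equiv.ofBijective (fun k => ⟨convDen a (2 * k + 1) * a, 2 * k + 1, ⟨k, rfl⟩, rfl⟩)
    ⟨fun k l h => ?_, ?_⟩, fun k => rfl, fun k l => ?_⟩
  · have := convDen_mul_inj ha ha0 (by omega) (by omega) (congrArg Subtype.val h)
    omega
  · rintro ⟨x, l, ⟨k, rfl⟩, rfl⟩
    exact ⟨k, rfl⟩
  · refine (convDen_mul_lt_iff ha ha0 (by omega) (by omega)).trans ?_
    omega

theorem exists_buchi_iso :
    ∃ (s : oddDen a → oddDen a) (h₁ : oddDen a → ℕ) (h₂ : oddDigitSet a → Set ℕ),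
        (∀ x : oddDen a, IsLeast {y : ℝ | y ∈ oddDen a ∧ (x : ℝ) < y} (s x : ℝ)) ∧
        DefinableInR₂ a {z | ∃ x : oddDen a, z = ((x : ℝ), (s x : ℝ))} ∧
        (∀ (x : oddDen a) (k : ℕ), (x : ℝ) = convDen a (2 * k + 1) * a → h₁ x = k) ∧
        (∀ c : oddDigitSet a,
          h₂ c = {k : ℕ | ((convDen a (2 * k + 1) : ℝ) * a, (c : ℝ)) ∈ digitRel a 1}) ∧
        BuchiSig.IsIso
          { succ := s,
            mem := fun (x : oddDen a) (c : oddDigitSet a) => ((x : ℝ), (c : ℝ)) ∈ digitRel a 1 }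
          buchi h₁ h₂ := by
  obtain ⟨e, he, hlt⟩ := exists_oddDen_equiv ha h1 h2
  have hleast : ∀ x : oddDen a,
      IsLeast {y : ℝ | y ∈ oddDen a ∧ (x : ℝ) < y} (e (e.symm x + 1) : ℝ) := by
    intro x
    obtain ⟨k, rfl⟩ := e.surjective x
    rw [e.symm_apply_apply]
    refine ⟨⟨Subtype.coe_prop _, (hlt _ _).2 (by omega)⟩, ?_⟩
    rintro y ⟨hy, hky⟩
    obtain ⟨l, hl⟩ := e.surjective ⟨y, hy⟩
    obtain rfl : (e l : ℝ) = y := by rw [hl]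
    rw [hlt] at hky
    rw [← not_lt, hlt]
    omega
  refine ⟨fun x => e (e.symm x + 1), e.symm, fun c => {k : ℕ |
    ((convDen a (2 * k + 1) : ℝ) * a, (c : ℝ)) ∈ digitRel a 1}, hleast, ?_, ?_, fun _ => rfl,
    e.symm.bijective, ⟨?_, ?_⟩, fun x => e.symm_apply_apply _, ?_⟩
  · rw [definableInR₂_iff]
    have key : DefPred a (fun v : Fin 2 → ℝ => v 0 ∈ oddDen a ∧ (v 1 ∈ oddDen a ∧ v 0 < v 1) ∧
        ∀ y, (y ∈ oddDen a ∧ v 0 < y) → v 1 ≤ y) := by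
      repeat' first
        | with_reducible exact defFun_var _
        | with_reducible apply DefPred.mem₁ (definable_oddDen ha h1 h2)
        | with_reducible apply DefPred.and
        | with_reducible apply DefPred.lt
        | with_reducible apply DefPred.le
        | with_reducible apply DefPred.all
        | with_reducible apply DefPred.imp
    refine key.congr fun v => ?_
    constructor
    · rintro ⟨x, hx⟩
      simp only [Prod.mk.injEq] at hx
      rw [hx.1, hx.2]
      exact ⟨x.2, (hleast x).1, fun y hy => (hleast x).2 hy⟩
    · rintro ⟨hx, hy, hmin⟩
      refine ⟨⟨v 0, hx⟩, Prod.ext rfl ?_⟩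
      exact IsLeast.unique ⟨hy, fun y hy => hmin y hy⟩ (hleast ⟨v 0, hx⟩)
  · intro x k hk
    rw [Equiv.symm_apply_eq]
    exact Subtype.ext (hk.trans (he k).symm)
  · rintro ⟨c, hc, b, hb, hodd⟩ ⟨c', hc', b', hb', hodd'⟩ h
    have hbb : b = b' := by
      funext l
      rcases Nat.eq_zero_or_pos l with rfl | hl
      · rw [hb.zero_eq_zero h1 h2, hb'.zero_eq_zero h1 h2]
      rcases Nat.even_or_odd l with hl' | ⟨k, rfl⟩
      · rw [(hodd l hl).2 hl', (hodd' l hl).2 hl']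
      · have h3 := Set.ext_iff.1 h k
        simp only [Set.mem_ofPred_eq, hb.mem_digitRel_iff ha h1 h2 hl,
          hb'.mem_digitRel_iff ha h1 h2 hl] at h3
        have h4 := (hodd _ hl).1
        have h5 := (hodd' _ hl).1
        omega
    subst hbb
    exact Subtype.ext (hb.hasSum.unique hb'.hasSum)
  · intro X
    classical
    -- The characteristic function of X, spread over the odd positions.
    obtain ⟨b, hb⟩ : ∃ b : ℕ → ℕ, ∀ l, b l = if ∃ k ∈ X, l = 2 * k + 1 then 1 else 0 :=
      ⟨_, fun _ => rfl⟩
    have h01 : ∀ l, b l = 0 ∨ b l = 1 := fun l => by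
      rw [hb]; split_ifs <;> simp
    have heven : ∀ l, Even l → b l = 0 := fun l hl => by
      rw [hb, if_neg]
      rintro ⟨k, _, rfl⟩
      exact Nat.not_even_iff_odd.2 ⟨k, rfl⟩ hl
    obtain ⟨c, hc⟩ := exists_isOstrowski_of_digits ha h1 h2 (heven 0 Even.zero) h01 heven
    refine ⟨⟨c, hc.mem_Ico ha h1 h2, b, hc, fun l _ => ⟨h01 l, heven l⟩⟩, ?_⟩
    ext k
    simp only [Set.mem_ofPred_eq, hc.mem_digitRel_iff ha h1 h2 (show 1 ≤ 2 * k + 1 by omega), hb]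
    simp
  · intro x c
    obtain ⟨k, rfl⟩ := e.surjective x
    simp only [buchi, e.symm_apply_apply, Set.mem_ofPred_eq, he]

end Digits

/-! ### Arbitrary irrational a: the copy for a' pulled back along division by m. -/

theorem definesCopyOfBuchi {a : ℝ} (ha : Irrational a) :
    @DefinesCopyOfBuchi latticeLang ℝ (structR a) := by
  obtain ⟨m, n, a', hm, hmn, ha', h1, h2⟩ := exists_scale ha
  obtain ⟨s, h₁, h₂, -, hs, -, -, hiso⟩ := exists_buchi_iso ha' h1 h2
  have hm' : (m : ℝ) ≠ 0 := by exact_mod_cast hm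
  have hequiv : ∀ S : Set ℝ, ∃ e : {v : Fin 1 → ℝ | v 0 / m ∈ S} ≃ S,
      ∀ v, (e v : ℝ) = (v : Fin 1 → ℝ) 0 / m := fun S =>
    ⟨{ toFun := fun v => ⟨(v : Fin 1 → ℝ) 0 / m, v.2⟩
       invFun := fun x => ⟨fun _ => m * x, by
        change m * (x : ℝ) / m ∈ S
        rw [mul_div_cancel_left₀ _ hm']
        exact x.2⟩
       left_inv := fun v => by
        ext i
        rw [Subsingleton.elim i 0]
        exact mul_div_cancel₀ _ hm'
       right_inv := fun x => Subtype.ext (mul_div_cancel_left₀ _ hm') }, fun v => rfl⟩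
  obtain ⟨e, he⟩ := hequiv (oddDen a')
  obtain ⟨e', he'⟩ := hequiv (oddDigitSet a')
  have hsum : ∀ v w : Fin 1 ⊕ Fin 1 → ℝ, v (Sum.inl 0) / m = w (Sum.inl 0) / m →
      v (Sum.inr 0) / m = w (Sum.inr 0) / m → v = w := by
    intro v w hl hr
    funext i
    rcases i with i | i <;> rw [Subsingleton.elim i 0]
    exacts [(div_left_inj' hm').1 hl, (div_left_inj' hm').1 hr]
  have hpair : ∀ S, DefinableInR₂ a' S → DefPred a (fun v : Fin 1 ⊕ Fin 1 → ℝ =>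
      (v (Sum.inl 0) / m, v (Sum.inr 0) / m) ∈ S) := fun S hS =>
    (DefPred.scale hm hmn hS).comap ![Sum.inl 0, Sum.inr 0]
  let := structR a
  refine ⟨1, 1, {v | v 0 / m ∈ oddDen a'}, {v | v 0 / m ∈ oddDigitSet a'},
    { succ := fun x => e.symm (s (e x))
      mem := fun x c => ((e x : ℝ), (e' c : ℝ)) ∈ digitRel a' 1 },
    ⟨DefPred.scale hm hmn (definable_oddDen ha' h1 h2),
      DefPred.scale hm hmn (definable_oddDigitSet ha' h1 h2), ?_, ?_⟩,
    h₁ ∘ e, h₂ ∘ e', hiso.bijective_fst.comp e.bijective, hiso.bijective_snd.comp e'.bijective,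
    fun x => ?_, fun x c => hiso.map_mem (e x) (e' c)⟩
  · refine DefPred.congr (hpair _ hs) fun v => ?_
    constructor
    · rintro ⟨x, rfl⟩
      refine ⟨e x, ?_⟩
      exact Prod.ext (he x).symm ((he _).symm.trans (congrArg _ (e.apply_symm_apply (s (e x)))))
    · rintro ⟨x, hx⟩
      simp only [Prod.mk.injEq] at hx
      refine ⟨e.symm x, hsum _ _ ?_ ?_⟩
      · rw [hx.1]
        simp only [Sum.elim_inl]
        rw [← he, e.apply_symm_apply]
      · rw [hx.2]
        simp only [Sum.elim_inr]
        rw [← he, e.apply_symm_apply, e.apply_symm_apply]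
  · refine DefPred.congr ((hpair _ (definable_digitRel ha' h1 h2 1)).and
      (((DefPred.scale hm hmn (definable_oddDen ha' h1 h2)).comap (fun _ => Sum.inl 0)).and
        ((DefPred.scale hm hmn (definable_oddDigitSet ha' h1 h2)).comap (fun _ => Sum.inr 0))))
      fun v => ?_
    constructor
    · rintro ⟨x, c, hxc, rfl⟩
      change ((e x : ℝ), (e' c : ℝ)) ∈ digitRel a' 1 at hxc
      rw [he, he'] at hxc
      exact ⟨hxc, x.2, c.2⟩
    · rintro ⟨hxc, hx, hc⟩
      refine ⟨⟨fun _ => v (Sum.inl 0), hx⟩, ⟨fun _ => v (Sum.inr 0), hc⟩, ?_, ?_⟩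
      · change ((e _ : ℝ), (e' _ : ℝ)) ∈ digitRel a' 1
        rw [he, he']
        exact hxc
      · exact hsum _ _ rfl rfl
  · simp only [Function.comp_apply, e.apply_symm_apply]
    exact hiso.map_succ (e x)

theorem theoremD :
    (∀ a : ℝ, Irrational a → @DefinesCopyOfBuchi latticeLang ℝ (structR a)) ∧
    (∀ a : ℝ, Irrational a → 3 / 2 < a → a < 2 →
      -- the set of all `q_k a` with `k ≥ 1` is definable through best approximations
      DefinableInR₂ a (bestApprox a) ∧
      bestDen a = {x | ∃ k : ℕ, 1 ≤ k ∧ x = convDen a k * a} ∧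
      DefinableInR₁ a (bestDen a) ∧
      -- Ostrowski digits exist, are unique, and the digits `0` and `1` are definable
      (∀ c ∈ Set.Ico (1 - a) (2 - a), ∃! b : ℕ → ℕ, IsOstrowski a b c) ∧
      DefinableInR₂ a (digitRel a 0) ∧
      DefinableInR₂ a (digitRel a 1) ∧
      -- the copy `(W, J', s_W, E₁)` of the Büchi structure, and its isomorphism
      DefinableInR₁ a (oddDen a) ∧
      DefinableInR₁ a (oddDigitSet a) ∧
      ∃ (s : oddDen a → oddDen a) (h₁ : oddDen a → ℕ) (h₂ : oddDigitSet a → Set ℕ),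
        (∀ x : oddDen a, IsLeast {y : ℝ | y ∈ oddDen a ∧ (x : ℝ) < y} (s x : ℝ)) ∧
        DefinableInR₂ a {z | ∃ x : oddDen a, z = ((x : ℝ), (s x : ℝ))} ∧
        (∀ (x : oddDen a) (k : ℕ), (x : ℝ) = convDen a (2 * k + 1) * a → h₁ x = k) ∧
        (∀ c : oddDigitSet a,
          h₂ c = {k : ℕ | ((convDen a (2 * k + 1) : ℝ) * a, (c : ℝ)) ∈ digitRel a 1}) ∧
        BuchiSig.IsIso
          { succ := s,
            mem := fun (x : oddDen a) (c : oddDigitSet a) => ((x : ℝ), (c : ℝ)) ∈ digitRel a 1 }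
          buchi h₁ h₂) := by
  refine ⟨fun a ha => definesCopyOfBuchi ha, fun a ha h1 h2 => ⟨definable_bestApprox h1,
    bestDen_eq ha h1 h2, definable_bestDen h1, fun c hc => ?_, definable_digitRel ha h1 h2 0,
    definable_digitRel ha h1 h2 1, definable_oddDen ha h1 h2, definable_oddDigitSet ha h1 h2,
    exists_buchi_iso ha h1 h2⟩⟩
  obtain ⟨b, hb⟩ := exists_isOstrowski ha h1 h2 hc
  exact ⟨b, hb, fun b' hb' => hb'.unique ha hb⟩
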